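/- Let $q$ be a prime power and let $m=qt+r<q^2$ with integers $t\ge 1$ and $0\le r\le q-1$. Let $D=P_1+\dots+P_{q^2}$ be the sum of all finite rational places of the rational function field $\mathbb F_{q^2}(x)$, and let $C=C_{\mathcal L}(D,mP_\infty)=\{(f(P_1),\dots,f(P_{q^2})) : f\in\mathcal L(mP_\infty)\}\subseteq\mathbb F_{q^2}^{q^2}$. Put $$(k,c)=\begin{cases}\big((t+1)^2+2r+1-2q,\ (q-t-1)^2\big) & \text{if } t\ge q-r-1,\\ \big(t^2-1,\ (q-t)^2-2(r+1)\big) & \text{if } t<q-r-1.\end{cases}$$ Then $k,c$ are non-negative integers and: (a) there is an entanglement-assisted quantum (QUENTA) code with parameters $[[q^2,k,q^2-m;c]]_q$, and it is MDS; (b) the Hermitian construction applied to $C$ gives an MDS QUENTA code with parameters $[[q^2,k+1,q^2-m;c]]_q$. Here an $[[n,k,d;c]]_q$ QUENTA code encodes $k$ logical qudits of dimension $q$ into $n$ physical qudits by an isometry acting on the logical qudits and on the sender's halves of $c$ maximally entangled pairs, the receiver keeping the other halves; $d$ is its minimum distance, the largest number such that every error acting on fewer than $d$ of the $n$ physical qudits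 is detected (when $k=0$, detection of an error $E$ means, as usual, that the expectation value of $E$ in the code state is the normalised trace of $E$). The code is MDS if $d=\lfloor (n-k+c)/2\rfloor+1$. A QUENTA code is obtained by the Hermitian construction from a code $C$ over $\mathbb F_{q^2}$ of length $n$ if it is the entanglement-assisted stabilizer code with stabilizer $C^{\perp_h}=\{x : \sum_i x_iy_i^q=0 \text{ for all } y\in C\}$: splitting the entries of vectors over $\mathbb F_{q^2}$ into their two coordinates in an $\mathbb F_q$-basis, the Weyl operator of each $s\in C^{\perp_h}$ is extended by a phase and a Weyl operator on the receiver's qudits, and the code space is the joint fixed space of the extended operators. -/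

import Mathlib

open scoped Kronecker Matrix

namespace Quenta

noncomputable section

/-- An entanglement-assisted quantum (QUENTA) code over qudits whose computational basis is labelled
by the alphabet `A`. It encodes `k` logical qudits into `n` physical qudits with the help of `c`
maximally entangled pairs: the sender applies an isometric encoding to the `k` logical qudits and to
her halves of the `c` pairs (a unitary on `n` qudits, the remaining `n - k - c` being ancillas in a
fixed state); the receiver keeps the other halves. -/
structure Code (A : Type*) [Fintype A] [DecidableEq A] (n k c : ℕ) where
  /-- The sender's encoding. -/
  enc : Matrix (Fin n → A) ((Fin k → A) × (Fin c → A)) ℂ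
  isometry : encᴴ * enc = 1

section Quantum

variable {A : Type*} [Fintype A] [DecidableEq A] {n k c : ℕ}

/-- The joint state of the `n` physical qudits and the receiver's `c` qudits that encodes the basis
state `l`: the encoding applied to the sender's part of `|l⟩ ⊗ |A|^(-c/2) ∑ b, |b⟩ ⊗ |b⟩`. -/
def Code.codeword (Q : Code A n k c) (l : Fin k → A) : (Fin n → A) × (Fin c → A) → ℂ :=
  fun p => Q.enc p.1 (l, p.2) / (Real.sqrt ((Fintype.card A : ℝ) ^ c) : ℂ)

/-- The code space, spanned by the (orthonormal) code words. -/
def Code.space (Q : Code A n k c) : Submodule ℂ ((Fin n → A) × (Fin c → A) → ℂ) :=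
  Submodule.span ℂ (Set.range Q.codeword)

/-- The operator on `n` qudits that acts as `E` on the qudits in `T` and as the identity on the
others. -/
def localOp (T : Finset (Fin n)) (E : Matrix (T → A) (T → A) ℂ) :
    Matrix (Fin n → A) (Fin n → A) ℂ :=
  fun x y => if ∀ i, i ∉ T → x i = y i then E (fun i => x i) (fun i => y i) else 0

/-- The code detects the error `E` on the physical qudits in `T` (the receiver's halves of the pairs
are error free): the error detection condition `Π (E ⊗ 1) Π = z Π` of Knill and Laflamme, in matrix
elements. That condition is empty if `k = 0`; then, by the usual convention, the expectation value
`z` must be the normalised trace of `E` (i.e. the code is pure). -/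
def Code.Detects (Q : Code A n k c) (T : Finset (Fin n)) (E : Matrix (T → A) (T → A) ℂ) : Prop :=
  ∃ z : ℂ,
    (∀ l l' : Fin k → A,
      star (Q.codeword l) ⬝ᵥ
          ((localOp T E ⊗ₖ (1 : Matrix (Fin c → A) (Fin c → A) ℂ)) *ᵥ Q.codeword l') =
        if l = l' then z else 0) ∧
    (k = 0 → z = E.trace / (Fintype.card A : ℂ) ^ T.card)

/-- `d` is the minimum distance of the code: the largest number such that every error on fewer than
`d` physical qudits is detected. -/
def Code.HasMinDist (Q : Code A n k c) (d : ℕ) : Prop :=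
  IsGreatest {d : ℕ | ∀ T : Finset (Fin n), T.card < d →
    ∀ E : Matrix (T → A) (T → A) ℂ, Q.Detects T E} d

/-- The quantum Singleton defect `⌊(n - k + c) / 2⌋ + 1 - d` is zero. -/
def Code.IsMDS (Q : Code A n k c) : Prop :=
  ∃ d : ℕ, Q.HasMinDist d ∧ ((n : ℤ) - k + c) / 2 + 1 - d = 0

end Quantum

section Classical

variable {K : Type*} [Field K] {n : ℕ}

/-- The Hermitian dual of a code over the field with `q ^ 2` elements. -/
def hermitianDual (q : ℕ) (C : Set (Fin n → K)) : Set (Fin n → K) :=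
  {x | ∀ y ∈ C, ∑ i, x i * y i ^ q = 0}

open scoped Classical in
/-- The Riemann-Roch space `L(m P∞)` of the rational function field over `K`: no poles at the finite
places and a pole of order at most `m` at infinity. -/
def riemannRochInfty (K : Type*) [Field K] (m : ℕ) : Set (RatFunc K) :=
  {f | (∀ v : IsDedekindDomain.HeightOneSpectrum (Polynomial K),
      v.valuation (RatFunc K) f ≤ 1) ∧
    RatFunc.inftyValuation K f ≤ WithZero.exp (m : ℤ)}

/-- The algebraic-geometry code `C_L(D, m P∞)` of the rational function field, where `D` is the sum
of the finite rational places `x = P i`. -/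
def agCode (P : Fin n → K) (m : ℕ) : Set (Fin n → K) :=
  {y | ∃ f ∈ riemannRochInfty K m, ∀ i, y i = f.eval (RingHom.id K) (P i)}

end Classical

section Construction

variable {F K : Type*} [Field F] [Fintype F] [DecidableEq F] [Field K] [Algebra F K] {n k c : ℕ}

/-- The Weyl operator `X(a) Z(b)` on `n` qudits, `X(a) |y⟩ = |y + a⟩` and
`Z(b) |y⟩ = χ (b · y) |y⟩`. -/
def weyl (χ : AddChar F ℂ) (a b : Fin n → F) : Matrix (Fin n → F) (Fin n → F) ℂ :=
  fun x y => if x = y + a then χ (∑ i, b i * y i) else 0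

/-- The Weyl operator labelled by a vector over the quadratic extension `K` of `F`, whose entries
are split into their two coordinates in a basis of `K` over `F`. -/
def weylExt (χ : AddChar F ℂ) (e : Module.Basis (Fin 2) F K) (v : Fin n → K) :
    Matrix (Fin n → F) (Fin n → F) ℂ :=
  weyl χ (fun i => e.repr (v i) 0) (fun i => e.repr (v i) 1)

/-- `Q` is obtained from the code `C` over the quadratic extension `K` of `F` by the Hermitian
construction: it is the entanglement-assisted stabilizer code with stabilizer `C^{⊥h}`. For every
`s` in the Hermitian dual of `C` the Weyl operator of `s` on the physical qudits is extended by some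
Weyl operator on the receiver's qudits and some phase, and the code space consists of all joint
states that are fixed by the extended operators. -/
def Code.IsHermitianConstruction (Q : Code F n k c) (C : Set (Fin n → K)) : Prop :=
  ∃ (χ : AddChar F ℂ) (e : Module.Basis (Fin 2) F K)
    (θ : (Fin n → K) → ℂ) (B : (Fin n → K) → (Fin c → K)),
    χ ≠ 1 ∧ (∀ s, ‖θ s‖ = 1) ∧
    ∀ φ : (Fin n → F) × (Fin c → F) → ℂ,
      φ ∈ Q.space ↔ ∀ s ∈ hermitianDual (Fintype.card F) C,
        θ s • ((weylExt χ e s ⊗ₖ weylExt χ e (B s)) *ᵥ φ) = φ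

end Construction

end

end Quenta

set_option linter.unusedSectionVars false

namespace Quenta

/-! ### Weyl operators -/

section Weyl

variable {F : Type*} [Field F] [Fintype F] [DecidableEq F] {κ : Type*} [Fintype κ] [DecidableEq κ]

/-! Write vectors of length `q ^ 2` as values of polynomials of degree below `q ^ 2`. The sum of `x
^ (j + q * k)` over the field vanishes unless `q ^ 2 - 1` divides the non-zero exponent, so the
Hermitian Gram matrix of the monomials is, up to sign, the permutation matrix of an involution
`partner`, with one extra entry at the top degree (`dvd_add_mul_iff`, `sum_evalVec_mul_pow`). If `j`
has base-`q` digits `a, b`, then `partner j` has digits `q - 1 - b, q - 1 - a`. Hence the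
stabilizer, the Hermitian dual of `C`, is spanned by the monomials whose partner exceeds `m`
(`mem_hermitianDual_agCode_iff`).

Weyl operators commute up to the character of a symplectic form, which is proportional to the
antisymmetrised Hermitian form (`exists_alt_mul_eq`). On the stabilizer it pairs only exponents that
lie above `m` together with their partners. Their number is `c`, a lattice point count.
`receiverVec` carries the opposite form on `c` qudits, so the extended operators commute, and it is
onto, so the receiver's state is maximally mixed and the joint fixed space comes from an encoding
isometry (`exists_stabilizerCode`). A trace computation gives its dimension `q ^ (k + 1)`.

Weyl operators commuting with the stabilizer come from `C`. A non-zero polynomial of degree at most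
`m` has at most `m` zeros, so every error on fewer than `q ^ 2 - m` qudits is detected purely. A
product of `m` linear factors gives a logical operator of weight `q ^ 2 - m` that fails to commute
with another logical operator, hence is undetected (`exists_hermitianConstruction`). Pure detection
passes to subcodes, and a subcode with one logical qudit less can be chosen to keep that error
undetected (`Code.exists_subcode`). The floor in the Singleton bound absorbs the lost qudit, so both
codes are MDS. -/

theorem addChar_map_sum {ι : Type*} (χ : AddChar F ℂ) (s : Finset ι) (f : ι → F) :
    χ (∑ i ∈ s, f i) = ∏ i ∈ s, χ (f i) := by
  classical
  induction s using Finset.induction_on with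
  | empty => simp
  | insert i s hi ih => rw [Finset.sum_insert hi, Finset.prod_insert hi, AddChar.map_add_eq_mul, ih]

/-- The Weyl operator `X(a) Z(b)` on qudits indexed by an arbitrary finite type. -/
noncomputable def weylOp (χ : AddChar F ℂ) (a b : κ → F) : Matrix (κ → F) (κ → F) ℂ :=
  fun x y => if x = y + a then χ (b ⬝ᵥ y) else 0

theorem weyl_eq_weylOp {n : ℕ} (χ : AddChar F ℂ) (a b : Fin n → F) :
    weyl χ a b = weylOp χ a b := rfl

theorem weylOp_mul (χ : AddChar F ℂ) (a b a' b' : κ → F) :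
    weylOp χ a b * weylOp χ a' b' = χ (b ⬝ᵥ a') • weylOp χ (a + a') (b + b') := by
  ext x z
  rw [Matrix.mul_apply, Finset.sum_eq_single (z + a')]
  · simp only [weylOp, Matrix.smul_apply, smul_eq_mul, if_true]
    have h : z + a' + a = z + (a + a') := by abel
    rw [h]
    split_ifs
    · rw [← AddChar.map_add_eq_mul, ← AddChar.map_add_eq_mul, dotProduct_add, add_dotProduct]
      congr 1; ring
    · simp
  · intro y _ hy
    simp [weylOp, hy]
  · simp

theorem weylOp_zero (χ : AddChar F ℂ) : weylOp χ (0 : κ → F) 0 = 1 := by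
  ext x y
  simp [weylOp, Matrix.one_apply]

theorem conjTranspose_weylOp (χ : AddChar F ℂ) (a b : κ → F) :
    (weylOp χ a b)ᴴ = χ (b ⬝ᵥ a) • weylOp χ (-a) (-b) := by
  ext x y
  simp only [weylOp, Matrix.conjTranspose_apply, Matrix.smul_apply, smul_eq_mul]
  by_cases h : y = x + a
  · have h' : x = y + -a := by rw [h]; abel
    rw [if_pos h, if_pos h', ← AddChar.map_add_eq_mul]
    simp only [RCLike.star_def]
    rw [← AddChar.map_neg_eq_conj, h, dotProduct_add, neg_dotProduct, neg_dotProduct]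
    congr 1; ring
  · have h' : ¬ x = y + -a := fun h' => h (by rw [h']; abel)
    simp [h, h']

theorem conjTranspose_weylOp_mul_self (χ : AddChar F ℂ) (a b : κ → F) :
    (weylOp χ a b)ᴴ * weylOp χ a b = 1 := by
  rw [conjTranspose_weylOp, Matrix.smul_mul, weylOp_mul, smul_smul, ← AddChar.map_add_eq_mul,
    neg_dotProduct]
  simp [weylOp_zero]

theorem sum_addChar_dotProduct {χ : AddChar F ℂ} (hχ : χ ≠ 1) (z : κ → F) :
    ∑ b : κ → F, χ (b ⬝ᵥ z) = if z = 0 then (Fintype.card F : ℂ) ^ Fintype.card κ else 0 := by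
  have h1 : ∀ b : κ → F, χ (b ⬝ᵥ z) = ∏ i, χ (b i * z i) := fun b =>
    addChar_map_sum χ _ _
  simp_rw [h1]
  rw [← Fintype.prod_sum (fun i (x : F) => χ (x * z i))]
  simp_rw [AddChar.sum_mulShift _ (AddChar.IsPrimitive.of_ne_one hχ)]
  split_ifs with hz
  · simp [hz]
  · obtain ⟨i, hi⟩ := Function.ne_iff.1 hz
    exact Finset.prod_eq_zero (Finset.mem_univ i) (by simpa using hi)

theorem trace_weylOp {χ : AddChar F ℂ} (hχ : χ ≠ 1) {a b : κ → F} (h : a ≠ 0 ∨ b ≠ 0) :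
    (weylOp χ a b).trace = 0 := by
  by_cases ha : a = 0
  · have hb : b ≠ 0 := by tauto
    have := sum_addChar_dotProduct hχ b
    rw [if_neg hb] at this
    simpa [Matrix.trace, weylOp, ha, dotProduct_comm b] using this
  · simp [Matrix.trace, weylOp, ha]

/-- Expansion of a matrix in Weyl operators. -/
theorem card_smul_eq_sum_weylOp {χ : AddChar F ℂ} (hχ : χ ≠ 1) (E : Matrix (κ → F) (κ → F) ℂ) :
    (Fintype.card F : ℂ) ^ Fintype.card κ • E =
      ∑ a : κ → F, ∑ b : κ → F, (∑ u, E (u + a) u * χ (-(b ⬝ᵥ u))) • weylOp χ a b := by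
  ext x y
  simp only [Matrix.smul_apply, Matrix.sum_apply, smul_eq_mul]
  -- Only the shift `x - y` reaches this entry; the sum over `b` is then Fourier inversion.
  rw [Finset.sum_eq_single (x - y)]
  · have h : ∀ b, weylOp χ (x - y) b x y = χ (b ⬝ᵥ y) := fun b => by simp [weylOp]
    simp_rw [h, Finset.sum_mul]
    rw [Finset.sum_comm]
    have h2 : ∀ u b, E (u + (x - y)) u * χ (-(b ⬝ᵥ u)) * χ (b ⬝ᵥ y) =
        E (u + (x - y)) u * χ (b ⬝ᵥ (y - u)) := fun u b => by
      rw [mul_assoc, ← AddChar.map_add_eq_mul, dotProduct_sub]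
      congr 2; ring
    simp_rw [h2, ← Finset.mul_sum, sum_addChar_dotProduct hχ]
    rw [Finset.sum_eq_single y]
    · simp [mul_comm]
    · intro u _ hu
      rw [if_neg (fun h => hu (sub_eq_zero.1 h).symm), mul_zero]
    · simp
  · intro a _ ha
    refine Finset.sum_eq_zero fun b _ => ?_
    have : ¬ x = y + a := fun h => ha (by rw [h]; abel)
    simp [weylOp, this]
  · simp

/-- A linear functional that kills every non-trivial Weyl operator is a multiple of the trace. -/
theorem functional_eq_trace {χ : AddChar F ℂ} (hχ : χ ≠ 1)
    (L : Matrix (κ → F) (κ → F) ℂ →ₗ[ℂ] ℂ)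
    (hL : ∀ a b : κ → F, a ≠ 0 ∨ b ≠ 0 → L (weylOp χ a b) = 0) (E : Matrix (κ → F) (κ → F) ℂ) :
    L E = E.trace / (Fintype.card F : ℂ) ^ Fintype.card κ * L 1 := by
  have hq : (Fintype.card F : ℂ) ^ Fintype.card κ ≠ 0 := by simp
  have h := congrArg L (card_smul_eq_sum_weylOp hχ E)
  simp only [map_smul, map_sum, smul_eq_mul] at h
  -- Only the identity survives in the Weyl expansion, and its coefficient is the trace.
  rw [Finset.sum_eq_single 0, Finset.sum_eq_single 0] at h
  · rw [weylOp_zero] at h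
    rw [div_mul_eq_mul_div, eq_div_iff hq, mul_comm, h]
    simp [Matrix.trace]
  · intro b _ hb
    rw [hL 0 b (Or.inr hb), mul_zero]
  · simp
  · intro a _ ha
    refine Finset.sum_eq_zero fun b _ => ?_
    rw [hL a b (Or.inl ha), mul_zero]
  · simp

end Weyl

/-! ### Weyl operators of the sender and the receiver, and their symplectic form -/

section Joint

variable {F K : Type*} [Field F] [Fintype F] [DecidableEq F] [Field K] [Algebra F K] {n c : ℕ}

/-- The symplectic form on vectors over a quadratic extension, in the coordinates of a basis. -/
noncomputable def symp (e : Module.Basis (Fin 2) F K) {ι : Type*} [Fintype ι] (v w : ι → K) : F :=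
  ∑ i, (e.repr (v i) 0 * e.repr (w i) 1 - e.repr (v i) 1 * e.repr (w i) 0)

/-- The Weyl operator of a pair of vectors on the sender's and the receiver's qudits. -/
noncomputable def jointWeyl (χ : AddChar F ℂ) (e : Module.Basis (Fin 2) F K) (v : Fin n → K)
    (w : Fin c → K) :
    Matrix ((Fin n → F) × (Fin c → F)) ((Fin n → F) × (Fin c → F)) ℂ :=
  weylExt χ e v ⊗ₖ weylExt χ e w

variable (χ : AddChar F ℂ) (e : Module.Basis (Fin 2) F K)

theorem weylExt_mul (v w : Fin n → K) :
    weylExt χ e v * weylExt χ e w =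
      χ (∑ i, e.repr (v i) 1 * e.repr (w i) 0) • weylExt χ e (v + w) := by
  simp only [weylExt, weyl_eq_weylOp]
  rw [weylOp_mul]
  congr 2
  · ext i; simp
  · ext i; simp

theorem jointWeyl_mul (v v' : Fin n → K) (w w' : Fin c → K) :
    jointWeyl χ e v w * jointWeyl χ e v' w' =
      χ ((∑ i, e.repr (v i) 1 * e.repr (v' i) 0) + ∑ i, e.repr (w i) 1 * e.repr (w' i) 0) •
        jointWeyl χ e (v + v') (w + w') := by
  rw [jointWeyl, jointWeyl, ← Matrix.mul_kronecker_mul, weylExt_mul, weylExt_mul,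
    Matrix.smul_kronecker, Matrix.kronecker_smul, smul_smul, ← AddChar.map_add_eq_mul]
  rfl

/-- This turns every commutation question into linear algebra: the operators commute exactly when
the character is trivial on the total symplectic form. -/
theorem jointWeyl_mul_comm (v v' : Fin n → K) (w w' : Fin c → K) :
    jointWeyl χ e v w * jointWeyl χ e v' w' =
      χ (symp e v' v + symp e w' w) • (jointWeyl χ e v' w' * jointWeyl χ e v w) := by
  rw [jointWeyl_mul, jointWeyl_mul, smul_smul, ← AddChar.map_add_eq_mul, add_comm v' v,
    add_comm w' w]
  congr 2
  simp only [symp, Finset.sum_sub_distrib]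
  simp only [mul_comm]
  ring

theorem weylExt_zero : weylExt χ e (0 : Fin n → K) = 1 := by
  simp only [weylExt, weyl_eq_weylOp]
  rw [← weylOp_zero χ]
  congr 1 <;> (ext i; simp)

theorem jointWeyl_zero : jointWeyl χ e (0 : Fin n → K) (0 : Fin c → K) = 1 := by
  rw [jointWeyl, weylExt_zero, weylExt_zero, Matrix.one_kronecker_one]

theorem conjTranspose_jointWeyl_mul_self (v : Fin n → K) (w : Fin c → K) :
    (jointWeyl χ e v w)ᴴ * jointWeyl χ e v w = 1 := by
  rw [jointWeyl, Matrix.conjTranspose_kronecker, ← Matrix.mul_kronecker_mul]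
  simp only [weylExt, weyl_eq_weylOp, conjTranspose_weylOp_mul_self, Matrix.one_kronecker_one]

theorem repr_ne_zero {v : Fin n → K} (hv : v ≠ 0) :
    (fun i => e.repr (v i) 0) ≠ 0 ∨ (fun i => e.repr (v i) 1) ≠ 0 := by
  by_contra! h
  refine hv (funext fun i => ?_)
  have : e.repr (v i) = 0 := by
    ext j
    fin_cases j
    · exact congrFun h.1 i
    · exact congrFun h.2 i
  simpa using this

theorem trace_jointWeyl {χ : AddChar F ℂ} (hχ : χ ≠ 1) {v : Fin n → K} (hv : v ≠ 0)
    (w : Fin c → K) : (jointWeyl χ e v w).trace = 0 := by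
  rw [jointWeyl, Matrix.trace_kronecker]
  have : (weylExt χ e v).trace = 0 := by
    rw [weylExt, weyl_eq_weylOp, trace_weylOp hχ (repr_ne_zero e hv)]
  rw [this, zero_mul]

end Joint

/-! ### Joint fixed spaces of commuting unitaries -/

/-- Take a minimal non-zero subspace invariant under the whole family. By commutation its
intersection with an eigenspace of any member is again invariant, so minimality makes every member
scalar on it. -/
theorem exists_common_eigenvector {V ι : Type*} [AddCommGroup V] [Module ℂ V]
    [FiniteDimensional ℂ V] [Nontrivial V] (f : ι → Module.End ℂ V)
    (hf : ∀ i j, Commute (f i) (f j)) :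
    ∃ v : V, v ≠ 0 ∧ ∃ μ : ι → ℂ, ∀ i, f i v = μ i • v := by
  obtain ⟨W, ⟨hW0, hWf⟩, hmin⟩ := IsArtinian.set_has_minimal
    {W : Submodule ℂ V | W ≠ ⊥ ∧ ∀ i, ∀ x ∈ W, f i x ∈ W} ⟨⊤, top_ne_bot, fun _ _ _ => trivial⟩
  have key : ∀ i, ∃ μ : ℂ, ∀ x ∈ W, f i x = μ • x := by
    intro i
    have : Nontrivial W := Submodule.nontrivial_iff_ne_bot.2 hW0
    obtain ⟨μ, hμ⟩ := Module.End.exists_eigenvalue ((f i).restrict (hWf i))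
    obtain ⟨w, hw⟩ := hμ.exists_hasEigenvector
    have hw1 : f i w = μ • (w : V) := congrArg Subtype.val hw.apply_eq_smul
    refine ⟨μ, fun x hx => ?_⟩
    by_contra hne
    refine hmin (W ⊓ Module.End.eigenspace (f i) μ) ⟨?_, ?_⟩ ?_
    · refine (Submodule.ne_bot_iff _).2 ⟨w, ⟨w.2, Module.End.mem_eigenspace_iff.2 hw1⟩, ?_⟩
      exact fun h => hw.2 (Subtype.ext h)
    · rintro j y ⟨hy1, hy2⟩
      refine ⟨hWf j y hy1, Module.End.mem_eigenspace_iff.2 ?_⟩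
      have h := LinearMap.congr_fun (hf i j).eq y
      simp only [Module.End.mul_apply] at h
      rw [h, Module.End.mem_eigenspace_iff.1 hy2, map_smul]
    · refine lt_of_le_of_ne inf_le_left fun h => hne ?_
      rw [← h] at hx
      exact Module.End.mem_eigenspace_iff.1 hx.2
  choose μ hμ using key
  obtain ⟨v, hv, hv0⟩ := (Submodule.ne_bot_iff _).1 hW0
  exact ⟨v, hv0, μ, fun i => hμ i v hv⟩

section Stabilizer

variable {G N : Type*} [AddCommGroup G] [Fintype G] [Fintype N] [DecidableEq N]

/-- The joint fixed space of the operators `θ s • U s`. -/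
def fixedSpace (U : G → Matrix N N ℂ) (θ : G → ℂ) : Submodule ℂ (N → ℂ) where
  carrier := {φ | ∀ s, θ s • (U s *ᵥ φ) = φ}
  zero_mem' s := by simp
  add_mem' {x y} hx hy s := by rw [Matrix.mulVec_add, smul_add, hx s, hy s]
  smul_mem' z x hx s := by rw [Matrix.mulVec_smul, smul_comm, hx s]

theorem star_mulVec_dotProduct_mulVec {U : Matrix N N ℂ} (hU : Uᴴ * U = 1) (x y : N → ℂ) :
    star (U *ᵥ x) ⬝ᵥ (U *ᵥ y) = star x ⬝ᵥ y := by
  rw [Matrix.star_mulVec, Matrix.dotProduct_mulVec, Matrix.vecMul_vecMul, hU, Matrix.vecMul_one]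

open scoped ComplexOrder in
theorem norm_eigenvalue_eq_one {U : Matrix N N ℂ} (hU : Uᴴ * U = 1) {x : N → ℂ} (hx : x ≠ 0)
    {μ : ℂ} (h : U *ᵥ x = μ • x) : ‖μ‖ = 1 := by
  have h1 := star_mulVec_dotProduct_mulVec hU x x
  rw [h, star_smul, smul_dotProduct, dotProduct_smul, smul_smul, smul_eq_mul] at h1
  have h2 : star x ⬝ᵥ x ≠ 0 := fun h => hx (dotProduct_star_self_eq_zero.1 h)
  have h3 : star μ * μ = 1 := by
    apply mul_right_cancel₀ h2
    rw [h1, one_mul]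
  have h4 := congrArg norm h3
  rw [norm_mul, norm_star, norm_one] at h4
  nlinarith [norm_nonneg μ]

/-- Commuting unitaries that multiply up to phases can be corrected by phases so that they have a
joint fixed space of dimension `|N| / |G|`. -/
theorem exists_phases [Nonempty N] (U : G → Matrix N N ℂ) (h0 : U 0 = 1)
    (hmul : ∀ s s', ∃ z : ℂ, U s * U s' = z • U (s + s'))
    (hcomm : ∀ s s', U s * U s' = U s' * U s) (hunit : ∀ s, (U s)ᴴ * U s = 1)
    (htr : ∀ s, s ≠ 0 → (U s).trace = 0) :
    ∃ θ : G → ℂ, (∀ s, ‖θ s‖ = 1) ∧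
      Fintype.card G * Module.finrank ℂ (fixedSpace U θ) = Fintype.card N := by
  -- The inverse eigenvalues on one common eigenvector are the required phases: they trivialise the
  -- cocycle of the projective representation `U`.
  obtain ⟨x, hx, μ, hμ⟩ := exists_common_eigenvector (fun s => Matrix.toLin' (U s)) (fun s s' => by
    rw [Commute, SemiconjBy, Module.End.mul_eq_comp, Module.End.mul_eq_comp, ← Matrix.toLin'_mul,
      ← Matrix.toLin'_mul, hcomm])
  simp only [Matrix.toLin'_apply] at hμ
  have hμ1 : ∀ s, ‖μ s‖ = 1 := fun s => norm_eigenvalue_eq_one (hunit s) hx (hμ s)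
  have hμ0 : ∀ s, μ s ≠ 0 := fun s h => by simpa [h] using hμ1 s
  have hz : ∀ s s', U s * U s' = (μ s * μ s' / μ (s + s')) • U (s + s') := by
    intro s s'
    obtain ⟨z, hz⟩ := hmul s s'
    have h1 := congrArg (fun M => M *ᵥ x) hz
    simp only [← Matrix.mulVec_mulVec, Matrix.smul_mulVec, hμ, Matrix.mulVec_smul, smul_smul] at h1
    have h2 : μ s' * μ s = z * μ (s + s') := smul_left_injective ℂ hx h1
    rw [hz, mul_comm (μ s), h2, mul_div_cancel_right₀ _ (hμ0 _)]
  have hμz : μ 0 = 1 := by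
    have := hμ 0
    rw [h0, Matrix.one_mulVec] at this
    exact smul_left_injective ℂ hx (by simpa using this.symm)
  refine ⟨fun s => (μ s)⁻¹, fun s => by rw [norm_inv, hμ1, inv_one], ?_⟩
  let ρ : Representation ℂ (Multiplicative G) (N → ℂ) :=
    { toFun := fun g => Matrix.toLin' ((μ g.toAdd)⁻¹ • U g.toAdd)
      map_one' := by simp [h0, hμz, Module.End.one_eq_id]
      map_mul' := fun g h => by
        rw [Module.End.mul_eq_comp, ← Matrix.toLin'_mul, Matrix.smul_mul, Matrix.mul_smul, hz,
          smul_smul, smul_smul, toAdd_mul]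
        congr 2
        have h1 := hμ0 g.toAdd
        have h2 := hμ0 h.toAdd
        field_simp }
  have hfix : ρ.invariants = fixedSpace U (fun s => (μ s)⁻¹) := by
    ext φ
    rw [Representation.mem_invariants]
    have h : ∀ g : Multiplicative G, ρ g φ = (μ g.toAdd)⁻¹ • (U g.toAdd *ᵥ φ) := fun g => by
      change Matrix.toLin' ((μ g.toAdd)⁻¹ • U g.toAdd) φ = _
      rw [Matrix.toLin'_apply, Matrix.smul_mulVec]
    simp only [h]
    exact Iff.rfl
  have hG : (Fintype.card (Multiplicative G) : ℂ) ≠ 0 := by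
    exact_mod_cast Fintype.card_ne_zero
  let _ : Invertible (Fintype.card (Multiplicative G) : ℂ) := invertibleOfNonzero hG
  -- The averaging projection onto the invariants has trace equal to their dimension, and only the
  -- neutral element contributes to it.
  have htrace := (Representation.isProj_averageMap ρ).trace
  have havg : ρ.averageMap =
      (Fintype.card (Multiplicative G) : ℂ)⁻¹ • ∑ g : Multiplicative G, ρ g := by
    simp [Representation.averageMap, GroupAlgebra.average, map_sum, Representation.asAlgebraHom_single]
  have hsum : LinearMap.trace ℂ (N → ℂ) (∑ g : Multiplicative G, ρ g) = Fintype.card N := by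
    rw [map_sum, Finset.sum_eq_single 1]
    · simp
    · intro g _ hg
      change LinearMap.trace ℂ (N → ℂ) (Matrix.toLin' ((μ g.toAdd)⁻¹ • U g.toAdd)) = 0
      rw [Matrix.trace_toLin'_eq, Matrix.trace_smul, htr g.toAdd (fun h => hg h), smul_zero]
    · simp
  rw [havg, map_smul, hsum, smul_eq_mul, inv_mul_eq_iff_eq_mul₀ hG, hfix] at htrace
  have : (Fintype.card N : ℂ) =
      ((Fintype.card G * Module.finrank ℂ (fixedSpace U (fun s => (μ s)⁻¹)) : ℕ) : ℂ) := by
    rw [htrace, Nat.cast_mul, Fintype.card_multiplicative]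
  exact_mod_cast this.symm

/-- Matrix elements, between vectors fixed by a unitary, of an operator that commutes with it only
up to a non-trivial phase vanish. -/
theorem star_dotProduct_mulVec_eq_zero {U E : Matrix N N ℂ} (hU : Uᴴ * U = 1) {θ z : ℂ}
    (hθ : ‖θ‖ = 1) (hz : z ≠ 1) (hE : E * U = z • (U * E)) {x y : N → ℂ}
    (hx : θ • (U *ᵥ x) = x) (hy : θ • (U *ᵥ y) = y) : star x ⬝ᵥ (E *ᵥ y) = 0 := by
  have h1 : star x ⬝ᵥ (E *ᵥ y) = z * (star x ⬝ᵥ (E *ᵥ y)) := by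
    -- Moving `U` past `E` costs the factor `z`; unitarity and the unit phase remove everything
    -- else.
    conv_lhs => rw [← hy, ← hx]
    rw [Matrix.mulVec_smul, Matrix.mulVec_mulVec, hE, Matrix.smul_mulVec, ← Matrix.mulVec_mulVec,
      star_smul, smul_dotProduct, dotProduct_smul, dotProduct_smul,
      star_mulVec_dotProduct_mulVec hU, smul_eq_mul, smul_eq_mul, smul_eq_mul]
    have h2 : star θ * θ = 1 := by
      rw [RCLike.star_def, Complex.conj_mul', hθ]; simp
    rw [← mul_assoc, h2, one_mul]
  have h2 : (z - 1) * (star x ⬝ᵥ (E *ᵥ y)) = 0 := by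
    rw [sub_mul, ← h1, one_mul, sub_self]
  exact (mul_eq_zero.1 h2).resolve_left (sub_ne_zero.2 hz)

/-- Every subspace of functions has an orthonormal basis, indexed by any type of the right size. -/
theorem exists_orthonormal_basis {ι : Type*} [Fintype ι] [DecidableEq ι] (V : Submodule ℂ (N → ℂ))
    (hι : Module.finrank ℂ V = Fintype.card ι) :
    ∃ ψ : ι → N → ℂ, (∀ l l', star (ψ l) ⬝ᵥ ψ l' = if l = l' then 1 else 0) ∧
      Submodule.span ℂ (Set.range ψ) = V := by
  let w : EuclideanSpace ℂ N ≃ₗ[ℂ] (N → ℂ) := WithLp.linearEquiv 2 ℂ (N → ℂ)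
  let V' : Submodule ℂ (EuclideanSpace ℂ N) := V.comap w.toLinearMap
  have hV' : V'.map w.toLinearMap = V := Submodule.map_comap_eq_of_surjective w.surjective V
  have hfin : Module.finrank ℂ V' = Fintype.card ι := by
    rw [← hι, ← hV', LinearEquiv.finrank_map_eq]
  let b := (stdOrthonormalBasis ℂ V').reindex
    (Fintype.equivOfCardEq (by simpa using hfin) : Fin (Module.finrank ℂ V') ≃ ι)
  refine ⟨fun l => w (b l), fun l l' => ?_, ?_⟩
  · have := orthonormal_iff_ite.1 b.orthonormal l l'
    rw [Submodule.coe_inner, EuclideanSpace.inner_eq_star_dotProduct] at this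
    rw [dotProduct_comm]
    exact this
  · have h := b.toBasis.span_eq
    rw [← hV']
    have h2 := congrArg (Submodule.map (w.toLinearMap ∘ₗ V'.subtype)) h
    rw [Submodule.map_span, Submodule.map_comp, Submodule.map_subtype_top, ← Set.range_comp] at h2
    rw [← h2]
    congr 2

end Stabilizer
/-! ### Codes, error detection and subcodes -/

section Codes

variable {A : Type*} [Fintype A] [DecidableEq A] {n k c : ℕ}

/-- The matrix element of an error between two code words. -/
noncomputable def Code.elem (Q : Code A n k c) (T : Finset (Fin n))
    (E : Matrix (T → A) (T → A) ℂ) (l l' : Fin k → A) : ℂ :=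
  star (Q.codeword l) ⬝ᵥ
    ((localOp T E ⊗ₖ (1 : Matrix (Fin c → A) (Fin c → A) ℂ)) *ᵥ Q.codeword l')

/-- The error is detected purely: it acts on the code space as its normalised trace. -/
def Code.DetectsPurely (Q : Code A n k c) (T : Finset (Fin n)) (E : Matrix (T → A) (T → A) ℂ) :
    Prop :=
  ∀ l l', Q.elem T E l l' = if l = l' then E.trace / (Fintype.card A : ℂ) ^ T.card else 0

theorem Code.DetectsPurely.detects {Q : Code A n k c} {T : Finset (Fin n)}
    {E : Matrix (T → A) (T → A) ℂ} (h : Q.DetectsPurely T E) : Q.Detects T E :=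
  ⟨_, h, fun _ => rfl⟩

theorem Code.hasMinDist_of_detects {Q : Code A n k c} {d : ℕ}
    (h : ∀ T : Finset (Fin n), T.card < d → ∀ E, Q.Detects T E) {T : Finset (Fin n)}
    (hT : T.card = d) {E : Matrix (T → A) (T → A) ℂ} (hE : ¬ Q.Detects T E) : Q.HasMinDist d := by
  refine ⟨h, fun d' hd' => ?_⟩
  by_contra hlt
  exact hE (hd' T (by omega) E)

theorem Code.isMDS_of_hasMinDist {Q : Code A n k c} {d : ℕ} (h : Q.HasMinDist d)
    (hd : ((n : ℤ) - k + c) / 2 + 1 = d) : Q.IsMDS :=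
  ⟨d, h, by rw [hd, sub_self]⟩

/-- The code with given orthonormal code words, whose reduced states on the receiver's side are
maximally mixed. -/
noncomputable def Code.ofBasis [Nonempty A] (ψ : (Fin k → A) → (Fin n → A) × (Fin c → A) → ℂ)
    (h : ∀ l l' b b', ∑ x, star (ψ l (x, b)) * ψ l' (x, b') =
      if l = l' ∧ b = b' then 1 / (Fintype.card A : ℂ) ^ c else 0) : Code A n k c where
  enc := Matrix.of fun x p => (Real.sqrt ((Fintype.card A : ℝ) ^ c) : ℂ) * ψ p.1 (x, p.2)
  isometry := by
    ext ⟨l, b⟩ ⟨l', b'⟩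
    have hs : (Real.sqrt ((Fintype.card A : ℝ) ^ c) : ℂ) * Real.sqrt ((Fintype.card A : ℝ) ^ c) =
        (Fintype.card A : ℂ) ^ c := by
      rw [← Complex.ofReal_mul, Real.mul_self_sqrt (by positivity)]
      simp
    have hq : (Fintype.card A : ℂ) ^ c ≠ 0 := by simp
    simp only [Matrix.mul_apply, Matrix.conjTranspose_apply, Matrix.of_apply, star_mul',
      RCLike.star_def, Complex.conj_ofReal]
    have h1 : ∀ x, (Real.sqrt ((Fintype.card A : ℝ) ^ c) : ℂ) * (starRingEnd ℂ) (ψ l (x, b)) *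
        ((Real.sqrt ((Fintype.card A : ℝ) ^ c) : ℂ) * ψ l' (x, b')) =
        (Fintype.card A : ℂ) ^ c * (star (ψ l (x, b)) * ψ l' (x, b')) := fun x => by
      rw [← hs, RCLike.star_def]; ring
    simp_rw [h1, ← Finset.mul_sum, h, Matrix.one_apply, Prod.mk.injEq]
    split_ifs
    · rw [mul_one_div_cancel hq]
    · simp

theorem Code.codeword_ofBasis [Nonempty A] (ψ : (Fin k → A) → (Fin n → A) × (Fin c → A) → ℂ)
    (h : ∀ l l' b b', ∑ x, star (ψ l (x, b)) * ψ l' (x, b') =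
      if l = l' ∧ b = b' then 1 / (Fintype.card A : ℂ) ^ c else 0) (l : Fin k → A) :
    (Code.ofBasis ψ h).codeword l = ψ l := by
  ext ⟨x, b⟩
  have hs : (Real.sqrt ((Fintype.card A : ℝ) ^ c) : ℂ) ≠ 0 := by
    simp
  simp only [Code.codeword, Code.ofBasis, Matrix.of_apply]
  rw [mul_div_cancel_left₀ _ hs]

/-- Composition of the encoding with an isometry on the logical qudits. -/
noncomputable def Code.comp {k' : ℕ} (Q : Code A n k c)
    (W : Matrix (Fin k → A) (Fin k' → A) ℂ) (hW : Wᴴ * W = 1) : Code A n k' c where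
  enc := Q.enc * (W ⊗ₖ (1 : Matrix (Fin c → A) (Fin c → A) ℂ))
  isometry := by
    rw [Matrix.conjTranspose_mul, Matrix.mul_assoc, ← Matrix.mul_assoc Q.encᴴ, Q.isometry,
      Matrix.one_mul, Matrix.conjTranspose_kronecker, ← Matrix.mul_kronecker_mul, hW,
      Matrix.conjTranspose_one, Matrix.one_mul, Matrix.one_kronecker_one]

theorem Code.codeword_comp {k' : ℕ} (Q : Code A n k c) (W : Matrix (Fin k → A) (Fin k' → A) ℂ)
    (hW : Wᴴ * W = 1) (l : Fin k' → A) :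
    (Q.comp W hW).codeword l = ∑ j, W j l • Q.codeword j := by
  ext ⟨x, b⟩
  simp only [Code.codeword, Code.comp, Matrix.mul_apply, Fintype.sum_prod_type, Finset.sum_apply,
    Pi.smul_apply, smul_eq_mul, Finset.sum_div]
  refine Finset.sum_congr rfl fun j _ => ?_
  rw [Finset.sum_eq_single b]
  · simp [Matrix.kroneckerMap_apply]; ring
  · intro b' _ hb'
    simp [Matrix.kroneckerMap_apply, hb']
  · simp

theorem Code.elem_comp {k' : ℕ} (Q : Code A n k c) (W : Matrix (Fin k → A) (Fin k' → A) ℂ)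
    (hW : Wᴴ * W = 1) (T : Finset (Fin n)) (E : Matrix (T → A) (T → A) ℂ) :
    (Matrix.of ((Q.comp W hW).elem T E)) = Wᴴ * Matrix.of (Q.elem T E) * W := by
  ext l l'
  simp only [Matrix.of_apply, Code.elem, Q.codeword_comp, Matrix.mul_apply, star_sum, star_smul,
    Matrix.mulVec_sum, Matrix.mulVec_smul, sum_dotProduct, dotProduct_sum, smul_dotProduct,
    dotProduct_smul, smul_eq_mul, Finset.sum_mul, Finset.mul_sum, Matrix.conjTranspose_apply]
  refine Finset.sum_congr rfl fun i _ => Finset.sum_congr rfl fun j _ => ?_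
  ring

theorem Code.of_elem_eq_smul_one {Q : Code A n k c} {T : Finset (Fin n)}
    {E : Matrix (T → A) (T → A) ℂ} {z : ℂ} :
    (∀ l l', Q.elem T E l l' = if l = l' then z else 0) ↔ Matrix.of (Q.elem T E) = z • 1 := by
  rw [← Matrix.ext_iff]
  simp [Matrix.one_apply]

/-- A compression of a scalar matrix is the same scalar. Since that scalar is the normalised trace,
the result also meets the convention for codes without logical qudits. -/
theorem Code.DetectsPurely.comp {k' : ℕ} {Q : Code A n k c} {T : Finset (Fin n)}
    {E : Matrix (T → A) (T → A) ℂ} (h : Q.DetectsPurely T E)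
    (W : Matrix (Fin k → A) (Fin k' → A) ℂ) (hW : Wᴴ * W = 1) :
    (Q.comp W hW).DetectsPurely T E := by
  refine Code.of_elem_eq_smul_one.2 ?_
  rw [Q.elem_comp, Code.of_elem_eq_smul_one.1 h, Matrix.mul_smul, Matrix.mul_one, Matrix.smul_mul,
    hW]

/-- A non-scalar matrix has a non-scalar compression to a coordinate subspace with at least two
coordinates. -/
theorem exists_injective_submatrix_ne_smul_one {I J : Type*} [DecidableEq I] [DecidableEq J]
    [Nontrivial J] (ι : J → I) (hι : Function.Injective ι) (M : Matrix I I ℂ)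
    (hM : ¬ ∃ z : ℂ, M = z • 1) :
    ∃ f : J → I, Function.Injective f ∧ ¬ ∃ z : ℂ, M.submatrix f f = z • 1 := by
  obtain ⟨u, v, huv⟩ := exists_pair_ne J
  have key : ∃ l₁ l₂, l₁ ≠ l₂ ∧ (M l₁ l₂ ≠ 0 ∨ M l₁ l₁ ≠ M l₂ l₂) := by
    by_contra! h
    refine hM ⟨M (ι u) (ι u), ?_⟩
    ext l l'
    by_cases hl : l = l'
    · subst hl
      by_cases hlu : l = ι u
      · simp [hlu]
      · simp [(h l (ι u) hlu).2]
    · simp [hl, (h l l' hl).1]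
  obtain ⟨l₁, l₂, h12, hne⟩ := key
  -- Two transpositions correct `ι`: one sends `ι u` to `l₁`, the other then sends the image `w` of
  -- `ι v` to `l₂` without moving `l₁`.
  let w := Equiv.swap (ι u) l₁ (ι v)
  have hw : w ≠ l₁ := by
    intro h
    have h2 : w = Equiv.swap (ι u) l₁ (ι u) := by rw [h, Equiv.swap_apply_left]
    exact huv (hι ((Equiv.swap (ι u) l₁).injective h2)).symm
  let f : J → I := fun j => Equiv.swap w l₂ (Equiv.swap (ι u) l₁ (ι j))
  have hfu : f u = l₁ := by
    simp only [f]
    rw [Equiv.swap_apply_left, Equiv.swap_apply_of_ne_of_ne hw.symm h12]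
  have hfv : f v = l₂ := Equiv.swap_apply_left w l₂
  refine ⟨f, (Equiv.injective _).comp ((Equiv.injective _).comp hι), ?_⟩
  rintro ⟨z, hz⟩
  have h1 := congrFun (congrFun hz u) v
  have h2 := congrFun (congrFun hz u) u
  have h3 := congrFun (congrFun hz v) v
  simp only [Matrix.submatrix_apply, hfu, hfv, Matrix.smul_apply, Matrix.one_apply, huv, if_true,
    if_false] at h1 h2 h3
  rcases hne with h | h
  · exact h (by simpa using h1)
  · exact h (by rw [h2, h3])

/-- A non-scalar matrix has no constant expectation value in unit vectors. -/
theorem exists_unit_vector_ne {I : Type*} [Fintype I] [DecidableEq I] (M : Matrix I I ℂ)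
    (hM : ¬ ∃ z : ℂ, M = z • 1) (z : ℂ) :
    ∃ ψ : I → ℂ, star ψ ⬝ᵥ ψ = 1 ∧ star ψ ⬝ᵥ (M *ᵥ ψ) ≠ z := by
  by_contra! h
  have hd : ∀ l, M l l = z := fun l => by
    simpa [← Pi.single_star] using h (Pi.single l 1) (by simp)
  refine hM ⟨z, ?_⟩
  ext l l'
  by_cases hl : l = l'
  · simp [hl, hd]
  -- Polarisation on the unit vectors `(e_l + u e_l') / √2`; the values `u = 1` and `u = I` together
  -- kill the off-diagonal entries.
  have hpol : ∀ u : ℂ, star u * u = 1 → u * M l l' + star u * M l' l = 0 := by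
    intro u hu
    have hs : ((Real.sqrt 2 : ℝ) : ℂ)⁻¹ * ((Real.sqrt 2 : ℝ) : ℂ)⁻¹ = 1 / 2 := by
      rw [← mul_inv, ← Complex.ofReal_mul, Real.mul_self_sqrt (by norm_num)]; norm_num
    have hstar : star (((Real.sqrt 2 : ℝ) : ℂ)⁻¹ • (Pi.single l 1 + u • Pi.single l' 1 : I → ℂ)) =
        ((Real.sqrt 2 : ℝ) : ℂ)⁻¹ • (Pi.single l 1 + star u • Pi.single l' 1) := by
      rw [star_smul, star_add, star_smul, ← Pi.single_star, ← Pi.single_star]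
      simp
    have h1 := h (((Real.sqrt 2 : ℝ) : ℂ)⁻¹ • (Pi.single l 1 + u • Pi.single l' 1)) (by
      rw [hstar, smul_dotProduct, dotProduct_smul, smul_smul, hs]
      simp [hl, Ne.symm hl]
      rw [RCLike.star_def, mul_comm] at hu
      rw [hu]; norm_num)
    rw [hstar, Matrix.mulVec_smul, smul_dotProduct, dotProduct_smul, smul_smul, hs] at h1
    simp only [Matrix.mulVec_add, Matrix.mulVec_smul, add_dotProduct, dotProduct_add,
      smul_dotProduct, dotProduct_smul, smul_eq_mul, single_dotProduct, Matrix.mulVec_single_one,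
      Matrix.col_apply, hd, one_mul] at h1
    linear_combination 2 * h1 - z * hu
  have h1 := hpol 1 (by simp)
  have h2 := hpol Complex.I (by simp)
  simp only [star_one, one_mul, RCLike.star_def, Complex.conj_I] at h1 h2
  have h3 : M l l' = 0 := by
    have hI : Complex.I * Complex.I = -1 := Complex.I_mul_I
    linear_combination (1 / 2) * h1 - (Complex.I / 2) * h2 + (M l l' - M l' l) / 2 * hI
  simp [hl, h3]

/-- A code with an undetected error on `d` qudits, that detects purely all errors on fewer qudits,
has a subcode with one logical qudit less and minimum distance `d`. -/
theorem Code.exists_subcode [Nontrivial A] (Q : Code A n (k + 1) c) {d : ℕ}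
    (hQ : ∀ T : Finset (Fin n), T.card < d → ∀ E, Q.DetectsPurely T E) {T : Finset (Fin n)}
    (hT : T.card = d) {E : Matrix (T → A) (T → A) ℂ} (hE : ¬ Q.Detects T E) :
    ∃ Q' : Code A n k c, Q'.HasMinDist d := by
  have hM : ¬ ∃ z : ℂ, Matrix.of (Q.elem T E) = z • 1 := by
    rintro ⟨z, hz⟩
    exact hE ⟨z, Code.of_elem_eq_smul_one.2 hz, fun h => by omega⟩
  suffices h : ∃ (W : Matrix (Fin (k + 1) → A) (Fin k → A) ℂ) (hW : Wᴴ * W = 1),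
      ¬ (Q.comp W hW).Detects T E by
    obtain ⟨W, hW, h⟩ := h
    exact ⟨Q.comp W hW, Code.hasMinDist_of_detects
      (fun T hT E => ((hQ T hT E).comp W hW).detects) hT h⟩
  rcases Nat.eq_zero_or_pos k with rfl | hk
  -- A single code state violates detection only through the trace convention, so choose a state
  -- whose expectation value is not the normalised trace.
  · obtain ⟨ψ, hψ1, hψ⟩ := exists_unit_vector_ne _ hM (E.trace / (Fintype.card A : ℂ) ^ T.card)
    refine ⟨Matrix.of fun l _ => ψ l, ?_, ?_⟩
    · ext a b
      rw [Subsingleton.elim a b, Matrix.one_apply_eq, ← hψ1]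
      rfl
    · rintro ⟨z, hz, hz0⟩
      apply hψ
      rw [← hz0 rfl]
      have h := congrFun (congrFun ((Q.elem_comp _ _ T E).symm.trans
        (Code.of_elem_eq_smul_one.1 hz)) default) default
      rw [Matrix.smul_apply, Matrix.one_apply_eq, smul_eq_mul, mul_one, Matrix.mul_assoc] at h
      exact h
  · have : Nonempty (Fin k) := ⟨⟨0, hk⟩⟩
    obtain ⟨a⟩ : Nonempty A := inferInstance
    -- For `k > 0` a subcode spanned by code words suffices; fixing the last logical qudit to `a`
    -- merely shows that the index set is large enough.
    obtain ⟨f, hf, hfM⟩ := exists_injective_submatrix_ne_smul_one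
      (fun l : Fin k → A => (Fin.snoc l a : Fin (k + 1) → A))
      (fun l l' h => (Fin.snoc_inj.1 h).1) _ hM
    have hsub : ∀ N : Matrix (Fin (k + 1) → A) (Fin (k + 1) → A) ℂ,
        ((1 : Matrix (Fin (k + 1) → A) (Fin (k + 1) → A) ℂ).submatrix id f)ᴴ * N *
          (1 : Matrix (Fin (k + 1) → A) (Fin (k + 1) → A) ℂ).submatrix id f =
        N.submatrix f f := fun N => by
      rw [Matrix.conjTranspose_submatrix, Matrix.conjTranspose_one]
      ext i j
      simp [Matrix.mul_apply, Matrix.one_apply]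
    have hW := hsub 1
    rw [Matrix.mul_one, Matrix.submatrix_one f hf] at hW
    refine ⟨(1 : Matrix _ _ ℂ).submatrix id f, hW, ?_⟩
    · rintro ⟨z, hz, -⟩
      refine hfM ⟨z, ?_⟩
      rw [← hsub, ← Q.elem_comp _ hW]
      exact Code.of_elem_eq_smul_one.1 hz

end Codes
/-! ### Entanglement-assisted stabilizer codes -/

section StabilizerCodes

variable {F K : Type*} [Field F] [Fintype F] [DecidableEq F] [Field K] [Algebra F K] {n k c : ℕ}

/-- The vector over the quadratic extension with given coordinates. -/
noncomputable def ofCoords (e : Module.Basis (Fin 2) F K) {ι : Type*} (a b : ι → F) : ι → K :=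
  fun i => a i • e 0 + b i • e 1

theorem repr_ofCoords_zero (e : Module.Basis (Fin 2) F K) {ι : Type*} (a b : ι → F) (i : ι) :
    e.repr (ofCoords e a b i) 0 = a i := by
  simp [ofCoords]

theorem repr_ofCoords_one (e : Module.Basis (Fin 2) F K) {ι : Type*} (a b : ι → F) (i : ι) :
    e.repr (ofCoords e a b i) 1 = b i := by
  simp [ofCoords]

theorem weylExt_ofCoords (χ : AddChar F ℂ) (e : Module.Basis (Fin 2) F K) (a b : Fin n → F) :
    weylExt χ e (ofCoords e a b) = weylOp χ a b := by
  simp only [weylExt, repr_ofCoords_zero, repr_ofCoords_one]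
  rfl

theorem ofCoords_ne_zero (e : Module.Basis (Fin 2) F K) {ι : Type*} {a b : ι → F}
    (h : a ≠ 0 ∨ b ≠ 0) : ofCoords e a b ≠ 0 := by
  intro h0
  rcases h with h | h
  · refine h (funext fun i => ?_)
    rw [← repr_ofCoords_zero e a b, h0]
    simp
  · refine h (funext fun i => ?_)
    rw [← repr_ofCoords_one e a b, h0]
    simp

theorem localOp_weylOp (χ : AddChar F ℂ) (e : Module.Basis (Fin 2) F K) (T : Finset (Fin n))
    (v : Fin n → K) (hv : ∀ i, i ∉ T → v i = 0) :
    localOp T (weylOp χ (fun i : T => e.repr (v i) 0) (fun i : T => e.repr (v i) 1)) =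
      weylExt χ e v := by
  ext x y
  have h1 : (x = y + fun i => e.repr (v i) 0) ↔ (∀ i, i ∉ T → x i = y i) ∧
      ((fun i : T => x i) = (fun i : T => y i) + fun i : T => e.repr (v i) 0) := by
    constructor
    · intro h
      refine ⟨fun i hi => ?_, ?_⟩
      · rw [h]; simp [hv i hi]
      · ext i; exact congrFun h i
    · rintro ⟨h2, h3⟩
      ext i
      by_cases hi : i ∈ T
      · exact congrFun h3 ⟨i, hi⟩
      · simp [h2 i hi, hv i hi]
  have h2 : (fun i : T => e.repr (v i) 1) ⬝ᵥ (fun i : T => y i) = ∑ i, e.repr (v i) 1 * y i := by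
    rw [dotProduct, Finset.sum_coe_sort T (fun i => e.repr (v i) 1 * y i)]
    refine Finset.sum_subset (Finset.subset_univ T) fun i _ hi => ?_
    rw [hv i hi]
    simp
  simp only [localOp, weylOp, weylExt, weyl, h1, h2]
  rw [← ite_and]

/-- `Q` is the stabilizer code of the operators `θ g • (W (s g) ⊗ W (B g))`. -/
def Code.IsStabilizerCode (Q : Code F n k c) (χ : AddChar F ℂ) (e : Module.Basis (Fin 2) F K)
    {G : Type*} (s : G → Fin n → K) (B : G → Fin c → K) (θ : G → ℂ) : Prop :=
  (∀ l l', star (Q.codeword l) ⬝ᵥ Q.codeword l' = if l = l' then 1 else 0) ∧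
  (∀ g, ‖θ g‖ = 1) ∧
  ∀ φ, φ ∈ Q.space ↔ ∀ g, θ g • (jointWeyl χ e (s g) (B g) *ᵥ φ) = φ

/-- `hsB` makes the extended operators commute; injectivity of `s` makes the non-trivial ones
traceless, so `hcard` fixes the dimension. `hB` makes the receiver's reduced state maximally mixed,
which is what lets the fixed space arise from an isometry on the sender's side. -/
theorem exists_stabilizerCode {χ : AddChar F ℂ} (hχ : χ ≠ 1) (e : Module.Basis (Fin 2) F K)
    {G : Type*} [AddCommGroup G] [Fintype G] (s : G →+ (Fin n → K)) (B : G →+ (Fin c → K))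
    (hs : Function.Injective s)
    (hsB : ∀ g g', symp e (s g) (s g') + symp e (B g) (B g') = 0)
    (hB : ∀ w : Fin c → K, w ≠ 0 → ∃ g, χ (symp e (B g) w) ≠ 1)
    (hcard : Fintype.card G * Fintype.card F ^ k = Fintype.card F ^ (n + c)) :
    ∃ (Q : Code F n k c) (θ : G → ℂ), Q.IsStabilizerCode χ e s B θ := by
  obtain ⟨θ, hθ, hdim⟩ := exists_phases (fun g => jointWeyl χ e (s g) (B g))
    (by simp [jointWeyl_zero])
    (fun g g' => ⟨_, by rw [jointWeyl_mul, ← map_add, ← map_add]⟩)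
    (fun g g' => by rw [jointWeyl_mul_comm, hsB, AddChar.map_zero_eq_one, one_smul])
    (fun g => conjTranspose_jointWeyl_mul_self χ e _ _)
    (fun g hg => trace_jointWeyl e hχ (fun h => hg (hs (by rw [h, map_zero]))) _)
  set V := fixedSpace (fun g => jointWeyl χ e (s g) (B g)) θ with hV
  have hdim' : Module.finrank ℂ V = Fintype.card (Fin k → F) := by
    have hG : 0 < Fintype.card G := Fintype.card_pos
    apply Nat.eq_of_mul_eq_mul_left hG
    rw [hdim, Fintype.card_prod, Fintype.card_fun, Fintype.card_fun, Fintype.card_fun,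
      Fintype.card_fin, Fintype.card_fin, Fintype.card_fin, hcard, pow_add]
  obtain ⟨ψ, hψ, hspan⟩ := exists_orthonormal_basis V hdim'
  have hfix : ∀ l g, θ g • (jointWeyl χ e (s g) (B g) *ᵥ ψ l) = ψ l := fun l => by
    have : ψ l ∈ V := hspan ▸ Submodule.subset_span ⟨l, rfl⟩
    exact this
  have hred : ∀ l l' b b', ∑ x, star (ψ l (x, b)) * ψ l' (x, b') =
      if l = l' ∧ b = b' then 1 / (Fintype.card F : ℂ) ^ c else 0 := by
    intro l l' b b'
    -- The entries of the reduced operator on the receiver's side are values of this functional on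
    -- matrix units. It kills non-trivial Weyl operators, as each fails to commute with some
    -- stabilizer operator, so it is a multiple of the trace.
    let L : Matrix (Fin c → F) (Fin c → F) ℂ →ₗ[ℂ] ℂ :=
      { toFun := fun E => star (ψ l) ⬝ᵥ
          (((1 : Matrix (Fin n → F) (Fin n → F) ℂ) ⊗ₖ E) *ᵥ ψ l')
        map_add' := fun E E' => by
          rw [Matrix.kronecker_add, Matrix.add_mulVec, dotProduct_add]
        map_smul' := fun z E => by
          rw [Matrix.kronecker_smul, Matrix.smul_mulVec, dotProduct_smul, RingHom.id_apply] }
    have hL : ∀ a b : Fin c → F, a ≠ 0 ∨ b ≠ 0 → L (weylOp χ a b) = 0 := by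
      intro a b hab
      obtain ⟨g, hg⟩ := hB _ (ofCoords_ne_zero e hab)
      have h1 : ((1 : Matrix (Fin n → F) (Fin n → F) ℂ) ⊗ₖ weylOp χ a b) =
          jointWeyl χ e 0 (ofCoords e a b) := by
        rw [jointWeyl, weylExt_zero, weylExt_ofCoords]
      change star (ψ l) ⬝ᵥ (((1 : Matrix (Fin n → F) (Fin n → F) ℂ) ⊗ₖ weylOp χ a b) *ᵥ ψ l') = 0
      rw [h1]
      refine star_dotProduct_mulVec_eq_zero (conjTranspose_jointWeyl_mul_self χ e (s g) (B g))
        (hθ g) hg ?_ (hfix l g) (hfix l' g)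
      rw [jointWeyl_mul_comm]
      simp [symp]
    have h := functional_eq_trace hχ L hL (Matrix.single b b' 1)
    have h1 : L (Matrix.single b b' 1) = ∑ x, star (ψ l (x, b)) * ψ l' (x, b') := by
      change star (ψ l) ⬝ᵥ (((1 : Matrix (Fin n → F) (Fin n → F) ℂ) ⊗ₖ
        Matrix.single b b' 1) *ᵥ ψ l') = _
      rw [dotProduct, Fintype.sum_prod_type]
      refine Finset.sum_congr rfl fun x _ => ?_
      rw [Finset.sum_eq_single b]
      · rw [Pi.star_apply, Matrix.mulVec, dotProduct, Finset.sum_eq_single (x, b')]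
        · simp [Matrix.kroneckerMap_apply]
        · rintro ⟨x', y⟩ _ hne
          by_cases hx : x = x'
          · have hy : b' ≠ y := fun hy => hne (by rw [hx, hy])
            simp [Matrix.kroneckerMap_apply, hy]
          · simp [Matrix.kroneckerMap_apply, hx]
        · simp
      · intro y _ hy
        have : (((1 : Matrix (Fin n → F) (Fin n → F) ℂ) ⊗ₖ
            Matrix.single b b' (1 : ℂ)) *ᵥ ψ l') (x, y) = 0 := by
          rw [Matrix.mulVec, dotProduct]
          refine Finset.sum_eq_zero fun p _ => ?_
          simp [Matrix.kroneckerMap_apply, hy.symm]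
        rw [this, mul_zero]
      · simp
    have h2 : L 1 = if l = l' then 1 else 0 := by
      change star (ψ l) ⬝ᵥ (((1 : Matrix (Fin n → F) (Fin n → F) ℂ) ⊗ₖ 1) *ᵥ ψ l') = _
      rw [Matrix.one_kronecker_one, Matrix.one_mulVec, hψ]
    rw [← h1, h, h2, Fintype.card_fin]
    by_cases hb : b = b'
    · subst hb
      by_cases hl : l = l' <;> simp [hl]
    · simp [hb, Matrix.trace_single_eq_of_ne]
  refine ⟨Code.ofBasis ψ hred, θ, ?_, hθ, ?_⟩
  · simpa only [Code.codeword_ofBasis] using hψ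
  · intro φ
    have h1 : (Code.ofBasis ψ hred).space = V := by
      rw [Code.space, ← hspan]
      congr 2
      ext1 l
      exact Code.codeword_ofBasis ψ hred l
    rw [h1]
    exact Iff.rfl

variable {χ : AddChar F ℂ} {e : Module.Basis (Fin 2) F K} {G : Type*} {s : G → Fin n → K}
  {B : G → Fin c → K} {θ : G → ℂ} {Q : Code F n k c}

theorem Code.codeword_mem_space (Q : Code F n k c) (l : Fin k → F) : Q.codeword l ∈ Q.space :=
  Submodule.subset_span ⟨l, rfl⟩

/-- A stabilizer code detects purely all errors on a set of qudits on which every non-trivial Weyl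
operator fails to commute with the stabilizer. -/
theorem Code.IsStabilizerCode.detectsPurely (hQ : Q.IsStabilizerCode χ e s B θ) (hχ : χ ≠ 1)
    (T : Finset (Fin n))
    (hT : ∀ v : Fin n → K, v ≠ 0 → (∀ i, i ∉ T → v i = 0) → ∃ g, χ (symp e (s g) v) ≠ 1)
    (E : Matrix (T → F) (T → F) ℂ) : Q.DetectsPurely T E := by
  obtain ⟨hψ, hθ, hspace⟩ := hQ
  intro l l'
  have hadd : ∀ E E' : Matrix (T → F) (T → F) ℂ, localOp T (E + E') = localOp T E + localOp T E' :=
    fun E E' => by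
      ext x y
      simp only [localOp, Matrix.add_apply]
      split_ifs <;> simp
  have hsmul : ∀ (z : ℂ) (E : Matrix (T → F) (T → F) ℂ), localOp T (z • E) = z • localOp T E :=
    fun z E => by
      ext x y
      simp only [localOp, Matrix.smul_apply]
      split_ifs <;> simp
  -- The matrix element is linear in the error and vanishes on non-trivial Weyl operators, so it is
  -- a multiple of the trace.
  let L : Matrix (T → F) (T → F) ℂ →ₗ[ℂ] ℂ :=
    { toFun := fun E => Q.elem T E l l'
      map_add' := fun E E' => by
        rw [Code.elem, hadd, Matrix.add_kronecker, Matrix.add_mulVec, dotProduct_add]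
        rfl
      map_smul' := fun z E => by
        rw [Code.elem, hsmul, Matrix.smul_kronecker, Matrix.smul_mulVec, dotProduct_smul]
        rfl }
  have hvec : ∀ a b : T → F, ∃ v : Fin n → K, (∀ i, i ∉ T → v i = 0) ∧
      (∀ i : T, v i = ofCoords e a b i) ∧ localOp T (weylOp χ a b) = weylExt χ e v := by
    intro a b
    let v : Fin n → K := fun i => if h : i ∈ T then ofCoords e a b ⟨i, h⟩ else 0
    have hv0 : ∀ i, i ∉ T → v i = 0 := fun i hi => by simp [v, hi]
    have hv1 : ∀ i : T, v i = ofCoords e a b i := fun i => by simp [v]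
    refine ⟨v, hv0, hv1, ?_⟩
    rw [← localOp_weylOp χ e T v hv0]
    congr 2
    · ext i; rw [hv1, repr_ofCoords_zero]
    · ext i; rw [hv1, repr_ofCoords_one]
  have hL : ∀ a b : T → F, a ≠ 0 ∨ b ≠ 0 → L (weylOp χ a b) = 0 := by
    intro a b hab
    obtain ⟨v, hv0, hv1, hv⟩ := hvec a b
    have hvne : v ≠ 0 := by
      intro h
      refine ofCoords_ne_zero e hab (funext fun i => ?_)
      rw [← hv1, h]; rfl
    obtain ⟨g, hg⟩ := hT v hvne hv0
    change star (Q.codeword l) ⬝ᵥ ((localOp T (weylOp χ a b) ⊗ₖ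
      (1 : Matrix (Fin c → F) (Fin c → F) ℂ)) *ᵥ Q.codeword l') = 0
    rw [hv, ← weylExt_zero χ e]
    change star (Q.codeword l) ⬝ᵥ (jointWeyl χ e v 0 *ᵥ Q.codeword l') = 0
    refine star_dotProduct_mulVec_eq_zero (conjTranspose_jointWeyl_mul_self χ e (s g) (B g))
      (hθ g) hg ?_ ((hspace _).1 (Q.codeword_mem_space l) g)
      ((hspace _).1 (Q.codeword_mem_space l') g)
    rw [jointWeyl_mul_comm]
    simp [symp]
  have h1 : L 1 = if l = l' then 1 else 0 := by
    have : localOp T (1 : Matrix (T → F) (T → F) ℂ) = 1 := by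
      ext x y
      simp only [localOp, Matrix.one_apply]
      by_cases h : x = y
      · simp [h]
      · have h2 : ¬ ((∀ i, i ∉ T → x i = y i) ∧ (fun i : T => x i) = fun i : T => y i) := by
          rintro ⟨h2, h3⟩
          refine h (funext fun i => ?_)
          by_cases hi : i ∈ T
          · exact congrFun h3 ⟨i, hi⟩
          · exact h2 i hi
        rw [← ite_and, if_neg h2, if_neg h]
    change star (Q.codeword l) ⬝ᵥ ((localOp T 1 ⊗ₖ
      (1 : Matrix (Fin c → F) (Fin c → F) ℂ)) *ᵥ Q.codeword l') = _
    rw [this, Matrix.one_kronecker_one, Matrix.one_mulVec, hψ]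
  have h := functional_eq_trace hχ L hL E
  rw [h1, Fintype.card_coe] at h
  change L E = _
  rw [h]
  split_ifs <;> simp

/-- Such an operator commutes with the whole extended stabilizer, so it preserves the joint fixed
space and acts as a logical operator. -/
theorem Code.IsStabilizerCode.mulVec_mem_space (hQ : Q.IsStabilizerCode χ e s B θ) {v : Fin n → K}
    (hv : ∀ g, symp e v (s g) = 0) {φ : (Fin n → F) × (Fin c → F) → ℂ} (hφ : φ ∈ Q.space) :
    jointWeyl χ e v (0 : Fin c → K) *ᵥ φ ∈ Q.space := by
  obtain ⟨-, -, hspace⟩ := hQ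
  rw [hspace] at hφ ⊢
  intro g
  rw [Matrix.mulVec_mulVec, jointWeyl_mul_comm, hv]
  have : symp e (0 : Fin c → K) (B g) = 0 := by simp [symp]
  rw [this, add_zero, AddChar.map_zero_eq_one, one_smul, ← Matrix.mulVec_mulVec,
    ← Matrix.mulVec_smul, hφ g]

/-- A Weyl operator that commutes with the stabilizer is not detected if another such operator does
not commute with it. -/
theorem Code.IsStabilizerCode.not_detects (hQ : Q.IsStabilizerCode χ e s B θ) {T : Finset (Fin n)}
    {v w : Fin n → K} (hvT : ∀ i, i ∉ T → v i = 0) (hv : ∀ g, symp e v (s g) = 0)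
    (hw : ∀ g, symp e w (s g) = 0) (hvw : χ (symp e w v) ≠ 1) :
    ¬ Q.Detects T (weylOp χ (fun i : T => e.repr (v i) 0) (fun i : T => e.repr (v i) 1)) := by
  rintro ⟨z, hz, -⟩
  have hψ := hQ.1
  rw [localOp_weylOp χ e T v hvT, ← weylExt_zero χ e] at hz
  change ∀ l l', star (Q.codeword l) ⬝ᵥ
    (jointWeyl χ e v (0 : Fin c → K) *ᵥ Q.codeword l') = _ at hz
  -- The operator of `v` preserves the code space, so detection would make it act there as the
  -- scalar `z`.
  have hcode : ∀ l, jointWeyl χ e v (0 : Fin c → K) *ᵥ Q.codeword l = z • Q.codeword l := by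
    intro l
    have hmem := hQ.mulVec_mem_space hv (Q.codeword_mem_space l)
    obtain ⟨a, ha⟩ := (Submodule.mem_span_range_iff_exists_fun ℂ).1 hmem
    have h1 : ∀ j, a j = if j = l then z else 0 := fun j => by
      rw [← hz j l, ← ha, dotProduct_sum]
      simp only [dotProduct_smul, hψ]
      simp
    rw [← ha]
    simp [h1]
  have hspan : ∀ φ ∈ Q.space, jointWeyl χ e v (0 : Fin c → K) *ᵥ φ = z • φ := by
    intro φ hφ
    obtain ⟨a, ha⟩ := (Submodule.mem_span_range_iff_exists_fun ℂ).1 hφ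
    rw [← ha, Matrix.mulVec_sum, Finset.smul_sum]
    refine Finset.sum_congr rfl fun j _ => ?_
    rw [Matrix.mulVec_smul, hcode, smul_comm]
  have hne : Q.codeword 0 ≠ 0 := fun h => by
    have := hψ 0 0
    simp [h] at this
  have hz1 : ‖z‖ = 1 :=
    norm_eigenvalue_eq_one (conjTranspose_jointWeyl_mul_self χ e v 0) hne (hcode 0)
  -- The operator of `w` also preserves the code space, and a scalar would commute with it, contrary
  -- to `hvw`.
  have hmem := hQ.mulVec_mem_space hw (Q.codeword_mem_space 0)
  have h1 := hspan _ hmem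
  rw [Matrix.mulVec_mulVec, jointWeyl_mul_comm, Matrix.smul_mulVec, ← Matrix.mulVec_mulVec, hcode,
    Matrix.mulVec_smul, smul_smul] at h1
  have h0 : symp e (0 : Fin c → K) (0 : Fin c → K) = 0 := by simp [symp]
  have hne' : jointWeyl χ e w (0 : Fin c → K) *ᵥ Q.codeword 0 ≠ 0 := fun h => by
    have h2 := star_mulVec_dotProduct_mulVec (conjTranspose_jointWeyl_mul_self χ e w
      (0 : Fin c → K)) (Q.codeword 0) (Q.codeword 0)
    rw [h, hψ] at h2
    simp at h2
  have h2 := smul_left_injective ℂ hne' h1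
  have hz0 : z ≠ 0 := fun h => by simp [h] at hz1
  apply hvw
  rw [h0, add_zero] at h2
  exact mul_right_cancel₀ hz0 (by rw [h2, one_mul])

end StabilizerCodes
/-! ### The pairing of exponents -/

section Exponents

variable {q : ℕ}

theorem mul_add_lt_sq {a b : ℕ} (ha : a < q) (hb : b < q) : q * a + b < q ^ 2 := by
  have : q * (a + 1) ≤ q * q := Nat.mul_le_mul_left q ha
  rw [pow_two]
  rw [mul_add, mul_one] at this
  omega

theorem sub_one_sub_lt {a : ℕ} (ha : a < q) : q - 1 - a < q := by
  omega

theorem sub_one_sub_sub {a : ℕ} (ha : a < q) : q - 1 - (q - 1 - a) = a := by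
  omega

theorem mul_add_mod_self {a b : ℕ} (hb : b < q) : (q * a + b) % q = b := by
  rw [Nat.mul_add_mod, Nat.mod_eq_of_lt hb]

theorem mul_add_div_self {a b : ℕ} (hb : b < q) : (q * a + b) / q = a := by
  rw [Nat.mul_add_div (by omega), Nat.div_eq_of_lt hb, add_zero]

theorem div_lt_of_lt_sq {j : ℕ} (hj : j < q ^ 2) : j / q < q :=
  Nat.div_lt_of_lt_mul (by rwa [pow_two] at hj)

theorem mod_lt_of_lt_sq {j : ℕ} (hj : j < q ^ 2) : j % q < q :=
  Nat.mod_lt _ (Nat.pos_of_ne_zero (by rintro rfl; simp at hj))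

/-- The involution on exponents: `x ^ j` and `x ^ k` are not orthogonal if `j` is the partner of
`k`. -/
def partner (j : Fin (q ^ 2)) : Fin (q ^ 2) :=
  ⟨q * (q - 1 - j % q) + (q - 1 - j / q), by
    have h1 := mod_lt_of_lt_sq j.2
    have h2 := div_lt_of_lt_sq j.2
    exact mul_add_lt_sq (sub_one_sub_lt h1) (sub_one_sub_lt h2)⟩

theorem partner_val (j : Fin (q ^ 2)) :
    (partner j : ℕ) = q * (q - 1 - j % q) + (q - 1 - j / q) := rfl

theorem partner_mod (j : Fin (q ^ 2)) : (partner j : ℕ) % q = q - 1 - j / q := by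
  have h2 := div_lt_of_lt_sq j.2
  rw [partner_val, mul_add_mod_self (sub_one_sub_lt h2)]

theorem partner_div (j : Fin (q ^ 2)) : (partner j : ℕ) / q = q - 1 - j % q := by
  have h2 := div_lt_of_lt_sq j.2
  rw [partner_val, mul_add_div_self (sub_one_sub_lt h2)]

theorem partner_partner (j : Fin (q ^ 2)) : partner (partner j) = j := by
  ext
  have h1 := mod_lt_of_lt_sq j.2
  have h2 := div_lt_of_lt_sq j.2
  rw [partner_val, partner_mod, partner_div]
  rw [sub_one_sub_sub h1, sub_one_sub_sub h2]
  exact Nat.div_add_mod _ _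

theorem partner_involutive : Function.Involutive (partner (q := q)) := partner_partner

/-- Modulo `q ^ 2 - 1`, multiplication by `q` swaps the two base-`q` digits; the partner is the
complement of the swapped number. -/
theorem partner_add (j : Fin (q ^ 2)) :
    (partner j : ℕ) + (q * (j % q) + j / q) = q ^ 2 - 1 := by
  have h1 := mod_lt_of_lt_sq j.2
  have h2 := div_lt_of_lt_sq j.2
  rw [partner_val]
  have h3 : q * (q - 1 - j % q) + q * (j % q) = q * (q - 1) := by
    rw [← mul_add]; congr 1; omega
  have h4 : q * (q - 1) + q = q ^ 2 := by
    rw [pow_two, ← Nat.mul_succ]; congr 1; omega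
  omega

theorem partner_eq_zero_iff (j : Fin (q ^ 2)) : (partner j : ℕ) = 0 ↔ (j : ℕ) = q ^ 2 - 1 := by
  have h1 := mod_lt_of_lt_sq j.2
  have h2 := div_lt_of_lt_sq j.2
  have h4 : q * (q - 1) + q = q ^ 2 := by
    rw [pow_two, ← Nat.mul_succ]; congr 1; omega
  constructor
  · intro h
    rw [partner_val, Nat.add_eq_zero_iff, Nat.mul_eq_zero] at h
    have h5 : (j : ℕ) % q = q - 1 := by omega
    have h6 : (j : ℕ) / q = q - 1 := by omega
    have := Nat.div_add_mod (j : ℕ) q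
    rw [h5, h6] at this
    omega
  · intro h
    have h5 : (j : ℕ) = q * (q - 1) + (q - 1) := by omega
    have h6 : (j : ℕ) % q = q - 1 := by rw [h5, mul_add_mod_self (by omega)]
    have h7 : (j : ℕ) / q = q - 1 := by rw [h5, mul_add_div_self (by omega)]
    rw [partner_val, h6, h7]
    simp

/-- The number `q ^ 2 - 1` divides `j + q k` only if `j` is the partner of `k`, or in the extremal
cases. -/
theorem dvd_add_mul_iff (hq : 2 ≤ q) (j k : Fin (q ^ 2)) :
    ((j : ℕ) + q * k ≠ 0 ∧ q ^ 2 - 1 ∣ (j : ℕ) + q * k) ↔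
      j = partner k ∨ ((j : ℕ) = q ^ 2 - 1 ∧ (k : ℕ) = q ^ 2 - 1) := by
  have h4 : 4 ≤ q ^ 2 := by nlinarith
  have hp := partner_add k
  have hN : (j : ℕ) + q * k = (q ^ 2 - 1) * (k / q) + (j + (q * (k % q) + k / q)) := by
    have h := Nat.div_add_mod (k : ℕ) q
    zify [show 1 ≤ q ^ 2 by omega]
    zify at h
    linear_combination (-(q : ℤ)) * h
  have hdvd : q ^ 2 - 1 ∣ (j : ℕ) + q * k ↔ q ^ 2 - 1 ∣ (j : ℕ) + (q * (k % q) + k / q) := by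
    rw [hN]
    exact Nat.dvd_add_right (Dvd.intro _ rfl)
  have hj := j.2
  have hz := partner_eq_zero_iff k
  rw [hdvd, Fin.ext_iff]
  constructor
  · rintro ⟨hne, x, hx⟩
    -- After reduction both summands are at most `q ^ 2 - 1`, so the quotient is 0, 1 or 2: the
    -- excluded zero exponent, the partner, or both exponents extremal.
    have hx3 : x < 3 := by
      by_contra h
      have : (q ^ 2 - 1) * 3 ≤ (q ^ 2 - 1) * x := Nat.mul_le_mul_left _ (by omega)
      omega
    interval_cases x
    · exfalso
      have hk0 : (k : ℕ) = 0 := by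
        have h1 : (k : ℕ) / q = 0 := (Nat.add_eq_zero_iff.1 (Nat.add_eq_zero_iff.1 hx).2).2
        have h2 : q * ((k : ℕ) % q) = 0 :=
          (Nat.add_eq_zero_iff.1 (Nat.add_eq_zero_iff.1 hx).2).1
        have h3 := Nat.div_add_mod (k : ℕ) q
        rcases Nat.mul_eq_zero.1 h2 with h | h
        · omega
        · rw [h1, h] at h3; omega
      apply hne
      rw [hk0]
      omega
    · left; omega
    · right
      have : (partner k : ℕ) = 0 := by omega
      exact ⟨by omega, hz.1 this⟩
  · rintro (h | ⟨h1, h2⟩)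
    · refine ⟨fun h0 => ?_, 1, by omega⟩
      have hj0 : (j : ℕ) = 0 := by omega
      have hk := hz.1 (by omega)
      have : q * (k : ℕ) = 0 := by omega
      rcases Nat.mul_eq_zero.1 this with h | h <;> omega
    · exact ⟨by omega, 2, by have := hz.2 h2; omega⟩

theorem lt_iff_lex {t r a b : ℕ} (hr : r < q) (hb : b < q) :
    q * t + r < q * a + b ↔ t < a ∨ (t = a ∧ r < b) := by
  constructor
  · intro h
    rcases lt_trichotomy t a with h1 | rfl | h1
    · exact Or.inl h1
    · exact Or.inr ⟨rfl, by omega⟩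
    · have : q * (a + 1) ≤ q * t := Nat.mul_le_mul_left q h1
      rw [mul_add, mul_one] at this
      omega
  · rintro (h | ⟨rfl, h⟩)
    · have : q * (t + 1) ≤ q * a := Nat.mul_le_mul_left q h
      rw [mul_add, mul_one] at this
      omega
    · omega

/-- The number of exponents above `q t + r` whose partner is also above `q t + r`, as a number of
lattice points. -/
theorem card_exponents {t r : ℕ} (hr : r < q) :
    (Finset.univ.filter fun j : Fin (q ^ 2) => q * t + r < j ∧ q * t + r < partner j).card =
      ((Finset.range q ×ˢ Finset.range q).filter fun p : ℕ × ℕ =>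
        (t < p.1 ∨ (t = p.1 ∧ r < q - 1 - p.2)) ∧ (t < p.2 ∨ (t = p.2 ∧ r < q - 1 - p.1))).card := by
  have key : ∀ j : Fin (q ^ 2), (q * t + r < (j : ℕ) ↔
      t < (j : ℕ) / q ∨ (t = (j : ℕ) / q ∧ r < (j : ℕ) % q)) := fun j => by
    rw [← lt_iff_lex hr (mod_lt_of_lt_sq j.2), Nat.div_add_mod]
  simp only [key, partner_mod, partner_div]
  -- In the coordinates `(j / q, q - 1 - j % q)` the involution is the swap, which makes the two
  -- conditions mirror images.
  refine Finset.card_bij (fun j _ => ((j : ℕ) / q, q - 1 - (j : ℕ) % q)) ?_ ?_ ?_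
  · intro j hj
    have h1 := mod_lt_of_lt_sq j.2
    have h2 := div_lt_of_lt_sq j.2
    have h3 : q - 1 - (q - 1 - (j : ℕ) % q) = j % q := by omega
    simp only [Finset.mem_filter, Finset.mem_univ, true_and] at hj
    simp only [Finset.mem_filter, Finset.mem_product, Finset.mem_range, h3]
    exact ⟨⟨h2, by omega⟩, hj⟩
  · intro j _ j' _ h
    have h1 := mod_lt_of_lt_sq j.2
    have h2 := mod_lt_of_lt_sq j'.2
    rw [Prod.mk.injEq] at h
    have h3 : (j : ℕ) % q = j' % q := by omega
    ext
    rw [← Nat.div_add_mod (j : ℕ) q, ← Nat.div_add_mod (j' : ℕ) q, h.1, h3]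
  · rintro ⟨a, b⟩ hab
    simp only [Finset.mem_filter, Finset.mem_product, Finset.mem_range] at hab
    obtain ⟨⟨ha, hb⟩, hab⟩ := hab
    have h1 : (q * a + (q - 1 - b)) / q = a := mul_add_div_self (by omega)
    have h2 : (q * a + (q - 1 - b)) % q = q - 1 - b := mul_add_mod_self (by omega)
    have h3 : q - 1 - (q - 1 - b) = b := by omega
    refine ⟨⟨q * a + (q - 1 - b), mul_add_lt_sq ha (by omega)⟩, ?_, ?_⟩
    · simp only [Finset.mem_filter, Finset.mem_univ, true_and, h1, h2, h3]
      exact hab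
    · simp only [h1, h2, h3]

/-- A point on the edge `a = t` needs `b < q - 1 - r ≤ t`, whereas the other condition gives `b ≥
t`; only the open square remains. -/
theorem card_exponents_of_ge {t r : ℕ} (hr : r < q) (h : q ≤ t + r + 1) :
    (Finset.univ.filter fun j : Fin (q ^ 2) => q * t + r < j ∧ q * t + r < partner j).card =
      (q - t - 1) ^ 2 := by
  rw [card_exponents hr]
  have : ((Finset.range q ×ˢ Finset.range q).filter fun p : ℕ × ℕ =>
        (t < p.1 ∨ (t = p.1 ∧ r < q - 1 - p.2)) ∧ (t < p.2 ∨ (t = p.2 ∧ r < q - 1 - p.1))) =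
      Finset.Ioo t q ×ˢ Finset.Ioo t q := by
    ext ⟨a, b⟩
    simp only [Finset.mem_filter, Finset.mem_product, Finset.mem_range, Finset.mem_Ioo]
    omega
  rw [this, Finset.card_product, Nat.card_Ioo, pow_two]

/-- The edges of the half-open square now count, except a segment of `r + 1` points on each; these
segments are disjoint because `t < q - 1 - r`. -/
theorem card_exponents_of_lt {t r : ℕ} (h : t + r + 1 < q) :
    (Finset.univ.filter fun j : Fin (q ^ 2) => q * t + r < j ∧ q * t + r < partner j).card
      + 2 * (r + 1) = (q - t) ^ 2 := by
  rw [card_exponents (by omega)]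
  have : ((Finset.range q ×ˢ Finset.range q).filter fun p : ℕ × ℕ =>
        (t < p.1 ∨ (t = p.1 ∧ r < q - 1 - p.2)) ∧ (t < p.2 ∨ (t = p.2 ∧ r < q - 1 - p.1))) =
      (Finset.Ico t q ×ˢ Finset.Ico t q) \
        (({t} ×ˢ Finset.Ico (q - 1 - r) q) ∪ (Finset.Ico (q - 1 - r) q ×ˢ {t})) := by
    ext ⟨a, b⟩
    simp only [Finset.mem_filter, Finset.mem_product, Finset.mem_range, Finset.mem_Ico,
      Finset.mem_sdiff, Finset.mem_union, Finset.mem_singleton]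
    omega
  rw [this]
  have hc : (({t} ×ˢ Finset.Ico (q - 1 - r) q) ∪ (Finset.Ico (q - 1 - r) q ×ˢ {t}) :
      Finset (ℕ × ℕ)).card = 2 * (r + 1) := by
    rw [Finset.card_union_of_disjoint, Finset.card_product, Finset.card_product,
      Finset.card_singleton, Nat.card_Ico]
    · omega
    · rw [Finset.disjoint_left]
      rintro ⟨a, b⟩
      simp only [Finset.mem_product, Finset.mem_Ico, Finset.mem_singleton]
      omega
  rw [← hc, Finset.card_sdiff_add_card_eq_card, Finset.card_product, Nat.card_Ico, pow_two]
  intro p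
  obtain ⟨a, b⟩ := p
  simp only [Finset.mem_product, Finset.mem_Ico, Finset.mem_union, Finset.mem_singleton]
  omega

/-- This is the dimension over `K` of the Hermitian dual of the code. -/
theorem card_lt_partner {m : ℕ} (hm : m < q ^ 2) :
    Fintype.card {j : Fin (q ^ 2) // m < partner j} = q ^ 2 - 1 - m := by
  rw [← Fintype.card_congr ((partner_involutive (q := q)).toPerm.subtypeEquiv
    (p := fun j : Fin (q ^ 2) => m < j) (fun j => by simp [partner_partner]))]
  rw [Fintype.card_subtype]
  have : (Finset.univ.filter fun j : Fin (q ^ 2) => m < (j : ℕ)) = Finset.Ioi ⟨m, hm⟩ := by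
    ext j
    simp [Fin.lt_def]
  rw [this, Fin.card_Ioi]

end Exponents
/-! ### Evaluation vectors over the quadratic extension -/

section Field

variable {F K : Type*} [Field F] [Fintype F] [DecidableEq F] [Field K] [Algebra F K] {q : ℕ}

theorem add_pow_fieldCard (hF : Fintype.card F = q) (x y : K) : (x + y) ^ q = x ^ q + y ^ q := by
  subst hF
  exact map_add (FiniteField.frobeniusAlgHom F K) x y

theorem sum_pow_fieldCard (hF : Fintype.card F = q) {ι : Type*} (s : Finset ι) (f : ι → K) :
    (∑ i ∈ s, f i) ^ q = ∑ i ∈ s, f i ^ q := by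
  subst hF
  exact map_sum (FiniteField.frobeniusAlgHom F K) f s

theorem smul_pow_fieldCard (hF : Fintype.card F = q) (a : F) (x : K) : (a • x) ^ q = a • x ^ q := by
  subst hF
  exact map_smul (FiniteField.frobeniusAlgHom F K) a x

/-- The alternating form on the quadratic extension, in coordinates. -/
noncomputable def alt (e : Module.Basis (Fin 2) F K) (x y : K) : F :=
  e.repr x 0 * e.repr y 1 - e.repr x 1 * e.repr y 0

theorem symp_eq_sum_alt (e : Module.Basis (Fin 2) F K) {ι : Type*} [Fintype ι] (v w : ι → K) :
    symp e v w = ∑ i, alt e (v i) (w i) := rfl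

theorem alt_zero_left (e : Module.Basis (Fin 2) F K) (x : K) : alt e 0 x = 0 := by simp [alt]

theorem alt_zero_right (e : Module.Basis (Fin 2) F K) (x : K) : alt e x 0 = 0 := by simp [alt]

theorem alt_neg_left (e : Module.Basis (Fin 2) F K) (x y : K) : alt e (-x) y = -alt e x y := by
  simp [alt]; ring

theorem exists_alt_eq (e : Module.Basis (Fin 2) F K) {x : K} (hx : x ≠ 0) (a : F) :
    ∃ y, alt e y x = a := by
  have h : e.repr x 0 ≠ 0 ∨ e.repr x 1 ≠ 0 := by
    by_contra! h
    apply hx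
    rw [← e.sum_repr x, Fin.sum_univ_two, h.1, h.2]
    simp
  rcases h with h | h
  · refine ⟨(-(a / e.repr x 0)) • e 1, ?_⟩
    simp [alt]
    field_simp
  · refine ⟨(a / e.repr x 1) • e 0, ?_⟩
    simp [alt]
    field_simp

theorem exists_addChar_alt_ne_one {χ : AddChar F ℂ} (hχ : χ ≠ 1) (e : Module.Basis (Fin 2) F K)
    {x : K} (hx : x ≠ 0) : ∃ y, χ (alt e y x) ≠ 1 := by
  obtain ⟨a, ha⟩ : ∃ a, χ a ≠ 1 := by
    by_contra! h
    exact hχ (by ext a; simp [h a])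
  obtain ⟨y, hy⟩ := exists_alt_eq e hx a
  exact ⟨y, by rwa [hy]⟩

theorem exists_addChar_symp_ne_one {χ : AddChar F ℂ} (hχ : χ ≠ 1) (e : Module.Basis (Fin 2) F K)
    {ι : Type*} [Fintype ι] [DecidableEq ι] {w : ι → K} (hw : w ≠ 0) :
    ∃ u, χ (symp e u w) ≠ 1 := by
  obtain ⟨i, hi⟩ := Function.ne_iff.1 hw
  obtain ⟨y, hy⟩ := exists_addChar_alt_ne_one hχ e hi
  refine ⟨Pi.single i y, ?_⟩
  rw [symp_eq_sum_alt, Finset.sum_eq_single i]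
  · simpa using hy
  · intro j _ hj
    simp [hj, alt_zero_left]
  · simp

/-- The alternating form is a multiple of `x y ^ q - x ^ q y`. -/
theorem exists_alt_mul_eq [Fintype K] (hF : Fintype.card F = q) (hK : Fintype.card K = q ^ 2)
    (e : Module.Basis (Fin 2) F K) :
    ∃ γ : K, γ ≠ 0 ∧ ∀ x y, algebraMap F K (alt e x y) * γ = x * y ^ q - x ^ q * y := by
  have hq : 2 ≤ q := hF ▸ Fintype.one_lt_card
  -- Both sides are alternating and bilinear over `F` on a plane, hence proportional; the factor is
  -- read off on the basis.
  have key : ∀ x y : K, algebraMap F K (alt e x y) * (e 0 * e 1 ^ q - e 0 ^ q * e 1) =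
      x * y ^ q - x ^ q * y := by
    intro x y
    have hx : x = e.repr x 0 • e 0 + e.repr x 1 • e 1 := by
      rw [← Fin.sum_univ_two (fun i => e.repr x i • e i), e.sum_repr]
    have hy : y = e.repr y 0 • e 0 + e.repr y 1 • e 1 := by
      rw [← Fin.sum_univ_two (fun i => e.repr y i • e i), e.sum_repr]
    have hxq : x ^ q = e.repr x 0 • e 0 ^ q + e.repr x 1 • e 1 ^ q := by
      conv_lhs => rw [hx]
      rw [add_pow_fieldCard hF, smul_pow_fieldCard hF, smul_pow_fieldCard hF]
    have hyq : y ^ q = e.repr y 0 • e 0 ^ q + e.repr y 1 • e 1 ^ q := by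
      conv_lhs => rw [hy]
      rw [add_pow_fieldCard hF, smul_pow_fieldCard hF, smul_pow_fieldCard hF]
    rw [alt]
    generalize e.repr x 0 = x₀ at *
    generalize e.repr x 1 = x₁ at *
    generalize e.repr y 0 = y₀ at *
    generalize e.repr y 1 = y₁ at *
    rw [hxq, hyq, hx, hy]
    simp only [map_sub, map_mul, Algebra.smul_def]
    ring
  refine ⟨_, fun h0 => ?_, key⟩
  -- If the factor vanished, `y = 1` would show that all of `K` is fixed by the `q`-th power,
  -- although `K` has `q ^ 2` elements.
  have h1 : ∀ x : Kˣ, x ^ (q - 1) = 1 := by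
    intro x
    have h := key x 1
    rw [h0, mul_zero, one_pow, mul_one, mul_one] at h
    have h2 : (x : K) ^ (q - 1) * x = 1 * x := by
      rw [← pow_succ, Nat.sub_add_cancel (by omega), one_mul]
      exact (sub_eq_zero.1 h.symm).symm
    ext
    exact mul_right_cancel₀ x.ne_zero h2
  have h2 := Nat.le_of_dvd (by omega) ((FiniteField.forall_pow_eq_one_iff K (q - 1)).1 h1)
  rw [hK] at h2
  have : 2 * q ≤ q ^ 2 := by nlinarith
  omega

/-- The exponent 0 is exceptional because `0 ^ 0 = 1`: the sum is then the cardinality of `K`, which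
is zero in `K`. -/
theorem sum_pow_eq_ite (K : Type*) [Field K] [Fintype K] (N : ℕ) :
    ∑ x : K, x ^ N = if N ≠ 0 ∧ Fintype.card K - 1 ∣ N then -1 else 0 := by
  classical
  rcases eq_or_ne N 0 with rfl | hN
  · simp
  · have h := FiniteField.sum_pow_units K N
    rw [if_congr (Iff.intro (fun h => h.2) (fun h => ⟨hN, h⟩)) rfl rfl, ← h,
      Fintype.sum_eq_add_sum_compl 0, zero_pow hN, zero_add]
    symm
    refine Finset.sum_bij (fun x _ => (x : K)) ?_ ?_ ?_ ?_
    · intro x _; simp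
    · intro x _ y _ hxy; exact Units.ext hxy
    · intro x hx
      exact ⟨Units.mk0 x (by simpa using hx), Finset.mem_univ _, rfl⟩
    · intro x _; rfl

/-- The vector of values at the points `P i` of the polynomial with given coefficients. -/
noncomputable def evalVec {n : ℕ} (P : Fin n → K) : (Fin n → K) →ₗ[K] (Fin n → K) :=
  (Matrix.vandermonde P).mulVecLin

theorem evalVec_apply {n : ℕ} (P : Fin n → K) (f : Fin n → K) (i : Fin n) :
    evalVec P f i = ∑ j, f j * P i ^ (j : ℕ) := by
  simp [evalVec, Matrix.mulVec, dotProduct, Matrix.vandermonde_apply, mul_comm]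

/-- This gives every error vector unique polynomial coefficients, in which all forms become
explicit. -/
theorem evalVec_bijective {n : ℕ} {P : Fin n → K} (hP : Function.Injective P) :
    Function.Bijective (evalVec P) := by
  have h : IsUnit (Matrix.vandermonde P) := by
    rw [Matrix.isUnit_iff_isUnit_det]
    exact isUnit_iff_ne_zero.2 (Matrix.det_vandermonde_ne_zero_iff.2 hP)
  exact ⟨Matrix.mulVec_injective_iff_isUnit.2 h, Matrix.mulVec_surjective_iff_isUnit.2 h⟩

theorem evalVec_coeff {n : ℕ} (P : Fin n → K) {p : Polynomial K} (hp : p.natDegree < n)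
    (i : Fin n) : evalVec P (fun j => p.coeff j) i = p.eval (P i) := by
  rw [evalVec_apply, Polynomial.eval_eq_sum_range' hp,
    Fin.sum_univ_eq_sum_range (fun j => p.coeff j * P i ^ j)]

/-- A non-zero vector of values of a polynomial of degree at most `m` has at most `m` zeros. -/
theorem exists_coeff_ne_zero {n m : ℕ} {P : Fin n → K} (hP : Function.Injective P)
    {f : Fin n → K} (hf : evalVec P f ≠ 0) {T : Finset (Fin n)} (hT : T.card < n - m)
    (h0 : ∀ i, i ∉ T → evalVec P f i = 0) : ∃ j : Fin n, m < (j : ℕ) ∧ f j ≠ 0 := by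
  classical
  by_contra! h
  let p : Polynomial K := ∑ j : Fin n, Polynomial.monomial (j : ℕ) (f j)
  have hp : p.natDegree ≤ m := by
    refine Polynomial.natDegree_sum_le_of_forall_le _ _ fun j _ => ?_
    by_cases hj : m < (j : ℕ)
    · simp [h j hj]
    · exact (Polynomial.natDegree_monomial_le _).trans (not_lt.1 hj)
  have heval : ∀ i, p.eval (P i) = evalVec P f i := fun i => by
    simp [p, evalVec_apply, Polynomial.eval_finsetSum, Polynomial.eval_monomial]
  have hp0 : p = 0 := by
    refine Polynomial.eq_zero_of_natDegree_lt_card_of_eval_eq_zero' p (Tᶜ.image P) ?_ ?_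
    · intro x hx
      obtain ⟨i, hi, rfl⟩ := Finset.mem_image.1 hx
      rw [heval, h0 i (Finset.mem_compl.1 hi)]
    · rw [Finset.card_image_of_injective _ hP, Finset.card_compl, Fintype.card_fin]
      omega
  refine hf (funext fun i => ?_)
  rw [← heval, hp0]
  simp

/-- Some monic polynomial with `m` distinct roots has a non-zero coefficient in degree `i`. -/
theorem exists_prod_coeff_ne_zero [Fintype K] [DecidableEq K] {m i : ℕ} (hm : m < Fintype.card K)
    (hi : i ≤ m) : ∃ R : Finset K, R.card = m ∧
      (∏ a ∈ R, (Polynomial.X - Polynomial.C a)).coeff i ≠ 0 := by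
  induction m, hi using Nat.le_induction with
  | base =>
    obtain ⟨R, -, hR⟩ := Finset.exists_subset_card_eq (s := (Finset.univ : Finset K)) (n := i)
      (by rw [Finset.card_univ]; exact hm.le)
    refine ⟨R, hR, ?_⟩
    have h1 : (∏ a ∈ R, (Polynomial.X - Polynomial.C a)).natDegree = i := by
      rw [Polynomial.natDegree_prod_of_monic _ _ (fun a _ => Polynomial.monic_X_sub_C a)]
      simp [hR]
    have h2 : (∏ a ∈ R, (Polynomial.X - Polynomial.C a)).Monic :=
      Polynomial.monic_prod_of_monic _ _ (fun a _ => Polynomial.monic_X_sub_C a)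
    have h3 := h2.coeff_natDegree
    rw [h1] at h3
    rw [h3]
    exact one_ne_zero
  | succ m him ih =>
    obtain ⟨R, hR, hne⟩ := ih (by omega)
    -- Adjoining either of two unused roots `a`, `b` to `R` gives products whose difference is `b -
    -- a` times the old one, so one of them keeps a non-zero coefficient.
    have hcard : 1 < Rᶜ.card := by rw [Finset.card_compl, hR]; omega
    obtain ⟨a, ha, b, hb, hab⟩ := Finset.one_lt_card.1 hcard
    rw [Finset.mem_compl] at ha hb
    by_contra! h
    have h1 := h (insert a R) (by rw [Finset.card_insert_of_notMem ha, hR])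
    have h2 := h (insert b R) (by rw [Finset.card_insert_of_notMem hb, hR])
    rw [Finset.prod_insert ha] at h1
    rw [Finset.prod_insert hb] at h2
    have h3 : (b - a) * (∏ a ∈ R, (Polynomial.X - Polynomial.C a)).coeff i = 0 := by
      rw [sub_mul, Polynomial.coeff_sub, Polynomial.coeff_C_mul] at h1 h2
      linear_combination h1 - h2
    rcases mul_eq_zero.1 h3 with h4 | h4
    · exact hab (sub_eq_zero.1 h4).symm
    · exact hne h4

/-- The Hermitian form in terms of coefficients. -/
theorem sum_evalVec_mul_pow [Fintype K] (hF : Fintype.card F = q) (hK : Fintype.card K = q ^ 2)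
    (P : Fin (q ^ 2) ≃ K) (f g : Fin (q ^ 2) → K) {top : Fin (q ^ 2)}
    (htop : (top : ℕ) = q ^ 2 - 1) :
    ∑ i, evalVec P f i * evalVec P g i ^ q =
      -(∑ j, f j * g (partner j) ^ q + f top * g top ^ q) := by
  have hq : 2 ≤ q := hF ▸ Fintype.one_lt_card
  have h4 : 4 ≤ q ^ 2 := by nlinarith
  have h1 : ∀ i, evalVec P f i * evalVec P g i ^ q =
      ∑ k, ∑ j, f j * g k ^ q * P i ^ ((j : ℕ) + q * k) := fun i => by
    rw [evalVec_apply, evalVec_apply, sum_pow_fieldCard hF, Finset.sum_mul_sum, Finset.sum_comm]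
    refine Finset.sum_congr rfl fun k _ => Finset.sum_congr rfl fun j _ => ?_
    rw [mul_pow, pow_add, ← pow_mul, mul_comm q]
    ring
  have h2 : ∀ j k : Fin (q ^ 2), ∑ i, P i ^ ((j : ℕ) + q * k) =
      (if j = partner k then -1 else 0) + if j = top ∧ k = top then -1 else 0 := fun j k => by
    have h3 : ((j : ℕ) = q ^ 2 - 1 ∧ (k : ℕ) = q ^ 2 - 1) ↔ (j = top ∧ k = top) := by
      rw [← htop, ← Fin.ext_iff, ← Fin.ext_iff]
    rw [P.sum_comp (fun x : K => x ^ ((j : ℕ) + q * k)), sum_pow_eq_ite, hK,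
      if_congr ((dvd_add_mul_iff hq j k).trans (or_congr_right h3)) rfl rfl]
    by_cases hj : j = partner k
    -- The two exceptional cases exclude each other, since the partner of the top exponent is 0.
    · have : ¬ (j = top ∧ k = top) := by
        rintro ⟨hj', rfl⟩
        have h5 := (partner_eq_zero_iff k).2 htop
        rw [← hj, hj', htop] at h5
        omega
      rw [if_pos (Or.inl hj), if_pos hj, if_neg this, add_zero]
    · rw [if_neg hj, zero_add]
      exact if_congr (by tauto) rfl rfl
  calc ∑ i, evalVec P f i * evalVec P g i ^ q
      = ∑ k, ∑ j, f j * g k ^ q * ∑ i, P i ^ ((j : ℕ) + q * k) := by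
        simp_rw [h1]
        rw [Finset.sum_comm]
        refine Finset.sum_congr rfl fun k _ => ?_
        rw [Finset.sum_comm]
        refine Finset.sum_congr rfl fun j _ => ?_
        rw [Finset.mul_sum]
    _ = ∑ k, -(f (partner k) * g k ^ q) + -(f top * g top ^ q) := by
        simp_rw [h2, mul_add, Finset.sum_add_distrib]
        congr 1
        · refine Finset.sum_congr rfl fun k _ => ?_
          simp
        · rw [Finset.sum_eq_single top, Finset.sum_eq_single top]
          · simp
          · intro j _ hj; simp [hj]
          · simp
          · intro k _ hk; simp [hk]
          · simp
    _ = _ := by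
        rw [Finset.sum_neg_distrib, neg_add]
        congr 2
        refine Fintype.sum_equiv partner_involutive.toPerm _ _ fun k => ?_
        simp [partner_partner]

/-- The symplectic form in terms of coefficients. -/
theorem symp_evalVec [Fintype K] (hF : Fintype.card F = q) (hK : Fintype.card K = q ^ 2)
    (P : Fin (q ^ 2) ≃ K) (e : Module.Basis (Fin 2) F K) (f g : Fin (q ^ 2) → K) {top : Fin (q ^ 2)}
    (htop : (top : ℕ) = q ^ 2 - 1) :
    symp e (evalVec P f) (evalVec P g) =
      -(∑ j, alt e (f j) (g (partner j)) + alt e (f top) (g top)) := by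
  -- Scaled by `γ`, the symplectic form is the difference of two Hermitian sums.
  obtain ⟨γ, hγ, h⟩ := exists_alt_mul_eq hF hK e
  apply (algebraMap F K).injective
  apply mul_right_cancel₀ hγ
  rw [symp_eq_sum_alt, map_sum, Finset.sum_mul, map_neg, neg_mul, map_add, add_mul, map_sum,
    Finset.sum_mul]
  simp_rw [h, Finset.sum_sub_distrib]
  have h1 := sum_evalVec_mul_pow hF hK P f g htop
  have h2 := sum_evalVec_mul_pow hF hK P g f htop
  have h3 : ∑ j, g j * f (partner j) ^ q = ∑ j, f j ^ q * g (partner j) := by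
    refine Fintype.sum_equiv partner_involutive.toPerm _ _ fun k => ?_
    simp [partner_partner, mul_comm]
  rw [h3] at h2
  have h4 : ∑ i, evalVec P f i ^ q * evalVec P g i = ∑ i, evalVec P g i * evalVec P f i ^ q :=
    Finset.sum_congr rfl fun i _ => mul_comm _ _
  rw [h4, h1, h2]
  ring

end Field

/-! ### The algebraic-geometry code as a polynomial evaluation code -/

section AGCode

variable {K : Type*} [Field K]

/-- Integrality at every finite place means being a polynomial, and the pole order at infinity of a
non-zero polynomial is its degree. -/
theorem mem_riemannRochInfty_iff {m : ℕ} {f : RatFunc K} :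
    f ∈ riemannRochInfty K m ↔
      ∃ p : Polynomial K, p.natDegree ≤ m ∧ algebraMap (Polynomial K) (RatFunc K) p = f := by
  classical
  have key : ∀ p : Polynomial K, RatFunc.inftyValuation K
      (algebraMap (Polynomial K) (RatFunc K) p) ≤ WithZero.exp (m : ℤ) ↔ p.natDegree ≤ m := by
    intro p
    rcases eq_or_ne p 0 with rfl | hp
    · simp
    · rw [RatFunc.inftyValuation_apply, RatFunc.inftyValuation.polynomial K hp, WithZero.exp_le_exp]
      exact Nat.cast_le
  constructor
  · rintro ⟨h1, h2⟩
    obtain ⟨p, rfl⟩ :=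
      IsDedekindDomain.HeightOneSpectrum.mem_integers_of_valuation_le_one (RatFunc K) f h1
    refine ⟨p, (key p).1 ?_, rfl⟩
    convert h2
  · rintro ⟨p, hp, rfl⟩
    refine ⟨fun v => v.valuation_le_one p, ?_⟩
    convert (key p).2 hp

theorem mem_agCode_iff {n m : ℕ} {P : Fin n → K} {y : Fin n → K} :
    y ∈ agCode P m ↔ ∃ p : Polynomial K, p.natDegree ≤ m ∧ ∀ i, y i = p.eval (P i) := by
  constructor
  · rintro ⟨f, hf, hy⟩
    obtain ⟨p, hp, rfl⟩ := mem_riemannRochInfty_iff.1 hf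
    refine ⟨p, hp, fun i => ?_⟩
    rw [hy, RatFunc.eval_algebraMap]
    rfl
  · rintro ⟨p, hp, hy⟩
    refine ⟨_, mem_riemannRochInfty_iff.2 ⟨p, hp, rfl⟩, fun i => ?_⟩
    rw [hy, RatFunc.eval_algebraMap]
    rfl

end AGCode

/-! ### The Hermitian dual in terms of monomials -/

section Dual

variable {F K : Type*} [Field F] [Fintype F] [DecidableEq F] [Field K] [Algebra F K] {q : ℕ}

/-- The Hermitian dual of the code consists of the values of the polynomials without the monomials
whose partner has degree at most `m`. -/
theorem mem_hermitianDual_agCode_iff [Fintype K] (hF : Fintype.card F = q)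
    (hK : Fintype.card K = q ^ 2) (P : Fin (q ^ 2) ≃ K) {m : ℕ} (hm : m < q ^ 2)
    (f : Fin (q ^ 2) → K) :
    evalVec P f ∈ hermitianDual q (agCode P m) ↔ ∀ j, (partner j : ℕ) ≤ m → f j = 0 := by
  have hq : 2 ≤ q := hF ▸ Fintype.one_lt_card
  have h4 : 4 ≤ q ^ 2 := by nlinarith
  let top : Fin (q ^ 2) := ⟨q ^ 2 - 1, by omega⟩
  have htop : (top : ℕ) = q ^ 2 - 1 := rfl
  have htop0 : (partner top : ℕ) = 0 := (partner_eq_zero_iff top).2 htop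
  constructor
  · intro h
    -- Pairing with the monomial of degree `k` isolates one coefficient, up to the top-degree
    -- correction.
    have key : ∀ k : Fin (q ^ 2), (k : ℕ) ≤ m →
        f (partner k) + f top * (if k = top then 1 else 0) = 0 := by
      intro k hk
      have hmem : evalVec P (Pi.single k 1) ∈ agCode P m := by
        refine mem_agCode_iff.2 ⟨Polynomial.X ^ (k : ℕ), by simpa using hk, fun i => ?_⟩
        rw [evalVec_apply, Finset.sum_eq_single k]
        · simp
        · intro j _ hj; simp [hj]
        · simp
      have h1 := h _ hmem
      rw [sum_evalVec_mul_pow hF hK P _ _ htop, neg_eq_zero, Finset.sum_eq_single (partner k)] at h1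
      · rw [partner_partner, Pi.single_eq_same, one_pow, mul_one] at h1
        have h2 : (if k = top then (1 : K) else 0) = (Pi.single k 1 : Fin (q ^ 2) → K) top ^ q := by
          rcases eq_or_ne k top with h | h
          · simp [h]
          · rw [if_neg h, Pi.single_eq_of_ne h.symm, zero_pow (by omega)]
        rw [h2]
        exact h1
      · intro j _ hj
        have : partner j ≠ k := fun h => hj (by rw [← h, partner_partner])
        simp [this, show q ≠ 0 by omega]
      · simp
    have hft : f top = 0 := by
      -- The partner of `top` is 0, so the constant polynomial isolates the top coefficient and the
      -- correction disappears.
      have h1 := key (partner top) (by omega)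
      rw [partner_partner] at h1
      have : partner top ≠ top := fun h => by rw [h] at htop0; omega
      simpa [this] using h1
    intro j hj
    have h1 := key (partner j) hj
    rwa [partner_partner, hft, zero_mul, add_zero] at h1
  · intro h y hy
    obtain ⟨p, hp, hy⟩ := mem_agCode_iff.1 hy
    have hy' : y = evalVec P (fun j => p.coeff j) := by
      ext i
      rw [evalVec_coeff _ (by omega), hy]
    rw [hy', sum_evalVec_mul_pow hF hK P _ _ htop, h top (by omega), zero_mul, add_zero,
      neg_eq_zero]
    refine Finset.sum_eq_zero fun j _ => ?_
    by_cases hj : (partner j : ℕ) ≤ m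
    · rw [h j hj, zero_mul]
    · rw [Polynomial.coeff_eq_zero_of_natDegree_lt (by omega), zero_pow (by omega), mul_zero]

end Dual
/-! ### The Hermitian construction -/

section Construction

variable {F K : Type*} [Field F] [Fintype F] [DecidableEq F] [Field K] [Algebra F K] {q : ℕ}

/-- Extension by zero of the coefficients of the monomials whose partner has degree above `m`. -/
def extendCoeffs {m : ℕ} : ({j : Fin (q ^ 2) // m < partner j} → K) →+ (Fin (q ^ 2) → K) where
  toFun g j := if h : m < partner j then g ⟨j, h⟩ else 0
  map_zero' := by ext j; simp
  map_add' g g' := by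
    ext j
    by_cases h : m < (partner j : ℕ) <;> simp [h]

theorem extendCoeffs_eq_zero {m : ℕ} (g : {j : Fin (q ^ 2) // m < partner j} → K)
    {j : Fin (q ^ 2)} (hj : (partner j : ℕ) ≤ m) : extendCoeffs g j = 0 :=
  dif_neg (not_lt.2 hj)

theorem extendCoeffs_partner_eq_zero {m : ℕ} (g : {j : Fin (q ^ 2) // m < partner j} → K)
    {j : Fin (q ^ 2)} (hj : (j : ℕ) ≤ m) : extendCoeffs g (partner j) = 0 :=
  extendCoeffs_eq_zero g (by rwa [partner_partner])

theorem exists_extendCoeffs_eq {m : ℕ} {f : Fin (q ^ 2) → K}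
    (hf : ∀ j, (partner j : ℕ) ≤ m → f j = 0) :
    ∃ g : {j : Fin (q ^ 2) // m < partner j} → K, extendCoeffs g = f := by
  refine ⟨fun j => f j, ?_⟩
  ext j
  change (if h : m < (partner j : ℕ) then f j else 0) = f j
  split_ifs with h
  · rfl
  · exact (hf j (not_lt.1 h)).symm

theorem extendCoeffs_injective {m : ℕ} :
    Function.Injective (extendCoeffs (q := q) (K := K) (m := m)) := by
  intro g g' h
  ext ⟨j, hj⟩
  have := congrFun h j
  change (if h : m < (partner j : ℕ) then g ⟨j, h⟩ else 0) =
    (if h : m < (partner j : ℕ) then g' ⟨j, h⟩ else 0) at this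
  rwa [dif_pos hj, dif_pos hj] at this

/-- The receiver's vector attached to a vector of coefficients. -/
noncomputable def receiverVec (e : Module.Basis (Fin 2) F K) {m c : ℕ}
    (σ : Fin c ≃ {j : Fin (q ^ 2) // m < j ∧ m < partner j}) :
    ({j : Fin (q ^ 2) // m < partner j} → K) →+ (Fin c → K) where
  toFun g := ofCoords e (fun i => e.repr (extendCoeffs g (σ i)) 0)
    (fun i => e.repr (extendCoeffs g (partner (σ i))) 1)
  map_zero' := by ext i; simp [ofCoords]
  map_add' g g' := by
    ext i
    simp only [ofCoords, map_add, Pi.add_apply, Finsupp.add_apply]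
    module

theorem receiverVec_apply (e : Module.Basis (Fin 2) F K) {m c : ℕ}
    (σ : Fin c ≃ {j : Fin (q ^ 2) // m < j ∧ m < partner j})
    (g : {j : Fin (q ^ 2) // m < partner j} → K) :
    receiverVec e σ g = ofCoords e (fun i => e.repr (extendCoeffs g (σ i)) 0)
      (fun i => e.repr (extendCoeffs g (partner (σ i))) 1) := rfl

theorem sum_comp_equiv_subtype {ι M : Type*} [Fintype ι] [AddCommMonoid M] {p : ι → Prop}
    [DecidablePred p] {c : ℕ} (σ : Fin c ≃ {j // p j}) {φ : ι → M} (hφ : ∀ j, ¬ p j → φ j = 0) :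
    ∑ i, φ (σ i) = ∑ j, φ j := by
  rw [σ.sum_comp (fun j => φ j), ← Finset.sum_subtype (Finset.univ.filter p) (by simp) φ,
    Finset.sum_filter_of_ne]
  intro j _ hj
  by_contra h
  exact hj (hφ j h)

/-- Taking the first coordinate at `j` and the second at `partner j` gives one half of each
alternating term; reindexing by `partner` gives the other half. The result cancels the sender's
form. -/
theorem symp_receiverVec (e : Module.Basis (Fin 2) F K) {m c : ℕ}
    (σ : Fin c ≃ {j : Fin (q ^ 2) // m < j ∧ m < partner j})
    (g g' : {j : Fin (q ^ 2) // m < partner j} → K) :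
    symp e (receiverVec e σ g) (receiverVec e σ g') =
      ∑ j, alt e (extendCoeffs g j) (extendCoeffs g' (partner j)) := by
  simp only [symp, receiverVec_apply, repr_ofCoords_zero, repr_ofCoords_one, alt,
    Finset.sum_sub_distrib]
  have hJ : ∀ j : Fin (q ^ 2), ¬ (m < (j : ℕ) ∧ m < (partner j : ℕ)) →
      (j : ℕ) ≤ m ∨ (partner j : ℕ) ≤ m := fun j h => by omega
  congr 1
  · rw [sum_comp_equiv_subtype σ (φ := fun j =>
      e.repr (extendCoeffs g j) 0 * e.repr (extendCoeffs g' (partner j)) 1)]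
    intro j hj
    rcases hJ j hj with h | h
    · simp [extendCoeffs_partner_eq_zero g' h]
    · simp [extendCoeffs_eq_zero g h]
  · rw [sum_comp_equiv_subtype σ (φ := fun j =>
      e.repr (extendCoeffs g (partner j)) 1 * e.repr (extendCoeffs g' j) 0)]
    · refine Fintype.sum_equiv partner_involutive.toPerm _ _ fun j => ?_
      simp [partner_partner]
    · intro j hj
      rcases hJ j hj with h | h
      · simp [extendCoeffs_partner_eq_zero g h]
      · simp [extendCoeffs_eq_zero g' h]

/-- Each coordinate that the receiver uses is read from a different free coefficient coordinate.
With the non-degenerate symplectic form this yields the hypothesis `hB` of `exists_stabilizerCode`.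
-/
theorem receiverVec_surjective (e : Module.Basis (Fin 2) F K) {m c : ℕ}
    (σ : Fin c ≃ {j : Fin (q ^ 2) // m < j ∧ m < partner j}) :
    Function.Surjective (receiverVec e σ) := by
  intro u
  let u' : Fin (q ^ 2) → K := fun j =>
    if h : m < (j : ℕ) ∧ m < (partner j : ℕ) then u (σ.symm ⟨j, h⟩) else 0
  have hu0 : ∀ j : Fin (q ^ 2), (j : ℕ) ≤ m ∨ (partner j : ℕ) ≤ m → u' j = 0 := fun j hj =>
    dif_neg (by omega)
  have hu1 : ∀ i, u' (σ i) = u i := fun i => by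
    simp only [u']
    rw [dif_pos (σ i).2]
    simp
  obtain ⟨g, hg⟩ := exists_extendCoeffs_eq (m := m)
    (f := ofCoords e (fun j => e.repr (u' j) 0) (fun j => e.repr (u' (partner j)) 1)) (by
      intro j hj
      simp [ofCoords, hu0 j (Or.inr hj), hu0 (partner j) (Or.inl hj)])
  refine ⟨g, ?_⟩
  ext i
  rw [receiverVec_apply, hg]
  simp only [ofCoords]
  conv_rhs => rw [← e.sum_repr (u i), Fin.sum_univ_two, ← hu1]
  simp [partner_partner]

/-- The Hermitian construction applied to the code gives an entanglement-assisted code that detects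
purely all errors of weight below `q ^ 2 - m` and fails to detect some error of that weight. -/
theorem exists_hermitianConstruction [Fintype K] (hF : Fintype.card F = q)
    (hK : Fintype.card K = q ^ 2) (P : Fin (q ^ 2) ≃ K) {m k c : ℕ} (hm : m < q ^ 2)
    (hc : c = (Finset.univ.filter fun j : Fin (q ^ 2) => m < (j : ℕ) ∧ m < (partner j : ℕ)).card)
    (hk : k + 2 * (q ^ 2 - 1 - m) = q ^ 2 + c) {i₀ : Fin (q ^ 2)} (hi₀ : (i₀ : ℕ) ≤ m)
    (hi₀m : (partner i₀ : ℕ) ≤ m) (hi₀0 : (i₀ : ℕ) ≠ 0) :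
    ∃ Q : Code F (q ^ 2) k c, Q.IsHermitianConstruction (agCode P m) ∧
      (∀ T : Finset (Fin (q ^ 2)), T.card < q ^ 2 - m → ∀ E, Q.DetectsPurely T E) ∧
      ∃ T : Finset (Fin (q ^ 2)), T.card = q ^ 2 - m ∧ ∃ E, ¬ Q.Detects T E := by
  classical
  have hq : 2 ≤ q := hF ▸ Fintype.one_lt_card
  have h4 : 4 ≤ q ^ 2 := by nlinarith
  obtain ⟨top, htop⟩ : ∃ top : Fin (q ^ 2), (top : ℕ) = q ^ 2 - 1 := ⟨⟨q ^ 2 - 1, by omega⟩, rfl⟩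
  have htop0 : (partner top : ℕ) = 0 := (partner_eq_zero_iff top).2 htop
  have hfin : Module.finrank F K = 2 := by
    have h := Module.card_eq_pow_finrank (K := F) (V := K)
    rw [hF, hK] at h
    exact (Nat.pow_right_injective hq h).symm
  let e : Module.Basis (Fin 2) F K := Module.finBasisOfFinrankEq F K hfin
  obtain ⟨χ, hχ⟩ : ∃ χ : AddChar F ℂ, χ ≠ 1 := by
    refine ⟨AddChar.FiniteField.primitiveChar_to_Complex F, fun h => ?_⟩
    have := AddChar.FiniteField.primitiveChar_to_Complex_isPrimitive F (one_ne_zero)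
    rw [AddChar.mulShift_one] at this
    exact this h
  let σ : Fin c ≃ {j : Fin (q ^ 2) // m < (j : ℕ) ∧ m < (partner j : ℕ)} :=
    Fintype.equivOfCardEq (by rw [Fintype.card_fin, Fintype.card_subtype, hc])
  let s : ({j : Fin (q ^ 2) // m < (partner j : ℕ)} → K) →+ (Fin (q ^ 2) → K) :=
    (evalVec P).toAddMonoidHom.comp extendCoeffs
  have hs : ∀ g, s g = evalVec P (extendCoeffs g) := fun g => rfl
  have hbij := evalVec_bijective P.injective
  have hsinj : Function.Injective s := hbij.1.comp extendCoeffs_injective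
  have htopg : ∀ g : {j : Fin (q ^ 2) // m < (partner j : ℕ)} → K, extendCoeffs g top = 0 :=
    fun g => extendCoeffs_eq_zero g (by omega)
  have hsB : ∀ g g', symp e (s g) (s g') + symp e (receiverVec e σ g) (receiverVec e σ g') = 0 := by
    intro g g'
    rw [hs, hs, symp_evalVec hF hK P e _ _ htop, symp_receiverVec, htopg, alt_zero_left]
    ring
  have hB : ∀ w : Fin c → K, w ≠ 0 → ∃ g, χ (symp e (receiverVec e σ g) w) ≠ 1 := by
    intro w hw
    obtain ⟨u, hu⟩ := exists_addChar_symp_ne_one hχ e hw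
    obtain ⟨g, rfl⟩ := receiverVec_surjective e σ u
    exact ⟨g, hu⟩
  have hcard : Fintype.card ({j : Fin (q ^ 2) // m < (partner j : ℕ)} → K) * Fintype.card F ^ k =
      Fintype.card F ^ (q ^ 2 + c) := by
    rw [Fintype.card_fun, card_lt_partner hm, hK, hF, ← pow_mul, ← pow_add, ← hk, add_comm]
  obtain ⟨Q, θ, hQ⟩ := exists_stabilizerCode hχ e s (receiverVec e σ) hsinj hsB hB hcard
  -- Vectors of `C` commute with the stabilizer and so give logical operators.
  have hcomm : ∀ f : Fin (q ^ 2) → K, (∀ j : Fin (q ^ 2), m < (j : ℕ) → f j = 0) →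
      ∀ g, symp e (evalVec P f) (s g) = 0 := by
    intro f hf g
    rw [hs, symp_evalVec hF hK P e _ _ htop, htopg, alt_zero_right, add_zero, neg_eq_zero]
    refine Finset.sum_eq_zero fun j _ => ?_
    by_cases hj : m < (j : ℕ)
    · rw [hf j hj, alt_zero_left]
    · rw [extendCoeffs_partner_eq_zero g (not_lt.1 hj), alt_zero_right]
  have hsingle : ∀ (j : Fin (q ^ 2)) (y : K) (f : Fin (q ^ 2) → K), (j : ℕ) ≠ 0 →
      symp e (evalVec P (Pi.single (partner j) (-y))) (evalVec P f) = alt e y (f j) := by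
    intro j y f hj
    have hjt : top ≠ partner j := fun h => hj (by rw [← htop0, h, partner_partner])
    rw [symp_evalVec hF hK P e _ _ htop, Pi.single_eq_of_ne hjt, alt_zero_left, add_zero,
      Finset.sum_eq_single (partner j)]
    · rw [Pi.single_eq_same, partner_partner, alt_neg_left, neg_neg]
    · intro i _ hi
      rw [Pi.single_eq_of_ne hi, alt_zero_left]
    · simp
  refine ⟨Q, ?_, ?_, ?_⟩
  -- The values 1 and 0 outside the stabilizer are arbitrary; only its elements are tested.
  · refine ⟨χ, e, Function.extend s θ (fun _ => 1), Function.extend s (receiverVec e σ) 0, hχ, ?_, ?_⟩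
    · intro v
      by_cases h : ∃ g, s g = v
      · obtain ⟨g, rfl⟩ := h
        rw [hsinj.extend_apply]
        exact hQ.2.1 g
      · rw [Function.extend_apply' _ _ _ h, norm_one]
    · intro φ
      rw [hQ.2.2, hF]
      constructor
      · intro h v hv
        obtain ⟨f, rfl⟩ := hbij.2 v
        obtain ⟨g, rfl⟩ := exists_extendCoeffs_eq
          ((mem_hermitianDual_agCode_iff hF hK P hm f).1 hv)
        rw [← hs, hsinj.extend_apply, hsinj.extend_apply]
        exact h g
      · intro h g
        have h1 := h (s g) ((mem_hermitianDual_agCode_iff hF hK P hm _).2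
          (fun j hj => extendCoeffs_eq_zero g hj))
        rw [hsinj.extend_apply, hsinj.extend_apply] at h1
        exact h1
  · intro T hT
    refine hQ.detectsPurely hχ T fun v hv hvT => ?_
    obtain ⟨f, rfl⟩ := hbij.2 v
    obtain ⟨j, hj, hfj⟩ := exists_coeff_ne_zero P.injective hv hT hvT
    obtain ⟨y, hy⟩ := exists_addChar_alt_ne_one hχ e hfj
    -- As `j` exceeds `m`, the monomial of degree `partner j` lies in the dual and detects the
    -- coefficient `f j`.
    obtain ⟨g, hg⟩ := exists_extendCoeffs_eq (m := m) (f := Pi.single (partner j) (-y)) (by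
      intro i hi
      refine Pi.single_eq_of_ne (fun h => ?_) _
      rw [h, partner_partner] at hi
      omega)
    refine ⟨g, ?_⟩
    rwa [hs, hg, hsingle j y f (by omega)]
  · obtain ⟨R, hR, hcoeff⟩ := exists_prod_coeff_ne_zero (K := K) (by rw [hK]; exact hm) hi₀
    set p : Polynomial K := ∏ a ∈ R, (Polynomial.X - Polynomial.C a) with hp
    have hdeg : p.natDegree = m := by
      rw [hp, Polynomial.natDegree_prod_of_monic _ _ (fun a _ => Polynomial.monic_X_sub_C a)]
      simp [hR]
    obtain ⟨y, hy⟩ := exists_addChar_alt_ne_one hχ e hcoeff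
    -- The vector of `p` lives off its `m` roots, while the monomial of degree `partner i₀`, also in
    -- `C`, pairs with the non-zero coefficient of `p` at `i₀`.
    refine ⟨Finset.univ.filter fun i => P i ∉ R, ?_, _, hQ.not_detects
      (v := evalVec P (fun j => p.coeff j))
      (w := evalVec P (Pi.single (partner i₀) (-y))) ?_ (hcomm _ ?_) (hcomm _ ?_) ?_⟩
    · have h1 : (Finset.univ.filter fun i => P i ∉ R) = (R.map P.symm.toEmbedding)ᶜ := by
        ext i
        simp
      rw [h1, Finset.card_compl, Finset.card_map, Fintype.card_fin, hR]
    · intro i hi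
      have hi' : P i ∈ R := by simpa using hi
      rw [evalVec_coeff _ (by omega), hp, Polynomial.eval_prod]
      exact Finset.prod_eq_zero hi' (by simp)
    · intro j hj
      exact Polynomial.coeff_eq_zero_of_natDegree_lt (by omega)
    · intro j hj
      exact Pi.single_eq_of_ne (fun h => by rw [h] at hj; omega) _
    · rwa [hsingle i₀ y _ hi₀0]

/-- The codes with `k + 1` and with `k` logical qudits, and their parameters. -/
theorem exists_mds_codes [Fintype K] (hF : Fintype.card F = q)
    (hK : Fintype.card K = q ^ 2) (P : Fin (q ^ 2) ≃ K) {m t r k c : ℕ} (hm : m = q * t + r)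
    (hmq : m < q ^ 2) (ht : 1 ≤ t)
    (hc : c = (Finset.univ.filter fun j : Fin (q ^ 2) => m < (j : ℕ) ∧ m < (partner j : ℕ)).card)
    (hk : k + 1 + 2 * (q ^ 2 - 1 - m) = q ^ 2 + c) :
    (∃ Q : Code F (q ^ 2) k c, Q.HasMinDist (q ^ 2 - m) ∧ Q.IsMDS) ∧
      ∃ Q : Code F (q ^ 2) (k + 1) c, Q.IsHermitianConstruction (agCode P m) ∧
        Q.HasMinDist (q ^ 2 - m) ∧ Q.IsMDS := by
  have hq : 2 ≤ q := hF ▸ Fintype.one_lt_card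
  have htq : t - 1 < q := by
    by_contra h
    have : q * q ≤ q * t := Nat.mul_le_mul_left q (by omega)
    rw [pow_two] at hmq
    omega
  have hqt : q ≤ q * t := Nat.le_mul_of_pos_right q (by omega)
  have hqt1 : q * (t - 1) + q = q * t := by
    rw [← Nat.mul_succ]; congr 1; omega
  -- This is `q * t - 1`, with partner `q - t`; both are at most `m` because `t ≥ 1`.
  let i₀ : Fin (q ^ 2) := ⟨q * (t - 1) + (q - 1), mul_add_lt_sq htq (by omega)⟩
  have hi₀ : (i₀ : ℕ) = q * (t - 1) + (q - 1) := rfl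
  have hpi₀ : (partner i₀ : ℕ) = q - 1 - (t - 1) := by
    rw [partner_val, hi₀, mul_add_mod_self (by omega), mul_add_div_self (by omega)]
    simp
  obtain ⟨Q, hQH, hQd, T, hT, E, hE⟩ := exists_hermitianConstruction hF hK P hmq hc hk
    (i₀ := i₀) (by omega) (by omega) (by omega)
  obtain ⟨Q', hQ'⟩ := Q.exists_subcode hQd hT hE
  have hQ : Q.HasMinDist (q ^ 2 - m) :=
    Code.hasMinDist_of_detects (fun T hT E => (hQd T hT E).detects) hT hE
  -- With `k + 1` logical qudits `n - k + c` becomes `2 * (q ^ 2 - 1 - m)`; with `k` it is one more,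
  -- which the floor discards.
  refine ⟨⟨Q', hQ', Code.isMDS_of_hasMinDist hQ' ?_⟩, Q, hQH, hQ, Code.isMDS_of_hasMinDist hQ ?_⟩
  · clear_value i₀
    zify [hmq.le, show 1 ≤ q ^ 2 by omega, show m ≤ q ^ 2 - 1 by omega] at hk ⊢
    omega
  · clear_value i₀
    zify [hmq.le, show 1 ≤ q ^ 2 by omega, show m ≤ q ^ 2 - 1 by omega] at hk ⊢
    omega

end Construction

end Quenta

/-! ### The parameters in the two ranges of `t` -/

theorem mainTheorem7 {F K : Type*} [Field F] [Fintype F] [DecidableEq F] [Field K] [Algebra F K]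
    (q : ℕ) (hF : Fintype.card F = q) (hK : Nat.card K = q ^ 2)
    (P : Fin (q ^ 2) ≃ K)
    (m t r : ℕ) (hm : m = q * t + r) (hmq : m < q ^ 2) (ht : 1 ≤ t) (hr : r ≤ q - 1) :
    ((t : ℤ) ≥ (q : ℤ) - r - 1 →
      ∃ k c : ℕ, (k : ℤ) = ((t : ℤ) + 1) ^ 2 + 2 * r + 1 - 2 * q ∧
        (c : ℤ) = ((q : ℤ) - t - 1) ^ 2 ∧
        (∃ Q : Quenta.Code F (q ^ 2) k c, Q.HasMinDist (q ^ 2 - m) ∧ Q.IsMDS) ∧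
        (∃ Q : Quenta.Code F (q ^ 2) (k + 1) c,
          Q.IsHermitianConstruction (Quenta.agCode P m) ∧
            Q.HasMinDist (q ^ 2 - m) ∧ Q.IsMDS)) ∧
    ((t : ℤ) < (q : ℤ) - r - 1 →
      ∃ k c : ℕ, (k : ℤ) = (t : ℤ) ^ 2 - 1 ∧
        (c : ℤ) = ((q : ℤ) - t) ^ 2 - 2 * ((r : ℤ) + 1) ∧
        (∃ Q : Quenta.Code F (q ^ 2) k c, Q.HasMinDist (q ^ 2 - m) ∧ Q.IsMDS) ∧
        (∃ Q : Quenta.Code F (q ^ 2) (k + 1) c,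
          Q.IsHermitianConstruction (Quenta.agCode P m) ∧
            Q.HasMinDist (q ^ 2 - m) ∧ Q.IsMDS)) := by
  have hq : 2 ≤ q := hF ▸ Fintype.one_lt_card
  let _ : Fintype K := Fintype.ofEquiv _ P
  rw [Nat.card_eq_fintype_card] at hK
  have htq : t < q := by
    by_contra h
    have : q * q ≤ q * t := Nat.mul_le_mul_left q (by omega)
    rw [pow_two] at hmq
    omega
  obtain ⟨c, hc⟩ : ∃ c, c = (Finset.univ.filter fun j : Fin (q ^ 2) =>
    m < (j : ℕ) ∧ m < (Quenta.partner j : ℕ)).card := ⟨_, rfl⟩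
  constructor
  · intro h
    have hcv : (c : ℤ) = ((q : ℤ) - t - 1) ^ 2 := by
      rw [hc, hm, Quenta.card_exponents_of_ge (by omega) (by omega)]
      push_cast [show t + 1 ≤ q by omega, Nat.sub_sub]
      ring
    -- Since `q ≤ t + r + 1`, the expression is at least `t ^ 2`.
    have hk0 : 0 ≤ ((t : ℤ) + 1) ^ 2 + 2 * r + 1 - 2 * q := by nlinarith
    obtain ⟨k, hk⟩ := Int.eq_ofNat_of_zero_le hk0
    refine ⟨k, c, hk.symm, hcv, Quenta.exists_mds_codes hF hK P hm hmq ht hc ?_⟩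
    zify [show 1 ≤ q ^ 2 by omega, show m ≤ q ^ 2 - 1 by omega]
    rw [← hk, hcv, hm]
    push_cast
    ring
  · intro h
    have hcv : (c : ℤ) = ((q : ℤ) - t) ^ 2 - 2 * ((r : ℤ) + 1) := by
      have h1 := Quenta.card_exponents_of_lt (q := q) (t := t) (r := r) (by omega)
      rw [← hm, ← hc] at h1
      zify [htq.le] at h1
      linarith
    have hk0 : 0 ≤ (t : ℤ) ^ 2 - 1 := by nlinarith
    obtain ⟨k, hk⟩ := Int.eq_ofNat_of_zero_le hk0
    refine ⟨k, c, hk.symm, hcv, Quenta.exists_mds_codes hF hK P hm hmq ht hc ?_⟩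
    zify [show 1 ≤ q ^ 2 by omega, show m ≤ q ^ 2 - 1 by omega]
    rw [← hk, hcv, hm]
    push_cast
    ring
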